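/- Let $\mathbb T^d=(\mathbb R/\mathbb Z)^d$, let $s$ be an integer with $s>d/2$, and for $m\ge 0$ let $H^s(\mathbb T^d,\mathbb R^m)$ be the space of (continuous representatives of) functions $f:\mathbb T^d\to\mathbb R^m$ with $\|f\|_{H^s}^2=\sum_{k\in\mathbb Z^d}(1+|k|^{2s})|\widehat f(k)|^2<\infty$, where $\widehat f(k)=\int_{\mathbb T^d}f(x)e^{-2\pi i\langle k,x\rangle}\,dx$. Let $|\cdot|$ be the Euclidean norm, $\|\cdot\|_2$ the induced matrix norm and $\|\cdot\|_F$ the Frobenius norm. For a positive integer $N$ let $[[N]]=\{-L,\dots,L\}$ if $N=2L+1$ and $[[N]]=\{-L,\dots,L-1\}$ if $N=2L$; let $[N]^d=\{0,\dots,N-1\}^d$, $x_n=n/N$ for $n\in[N]^d$, and for grid values $u=(u(x_n))_{n\in[N]^d}$ let $\mathsf{DFT}(u)(k)=N^{-d}\sum_{n\in[N]^d}u(x_n)e^{-2\pi i\langle k,x_n\rangle}$. A Fourier neural operator with $T$ layers, channel dimensions $d_0,\dots,d_T$ and mode count $K\ge1$ consists of shallow networks $\mathcal P(u)=\sigma_p(A_pu+b_p)$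 from $\mathbb R^{d_a}$ to $\mathbb R^{d_0}$ and $\mathcal Q(u)=\sigma_q(A_qu+b_q)$ from $\mathbb R^{d_T}$ to $\mathbb R^{d_u}$, and, for $0\le t<T$, of an activation $\sigma_t:\mathbb R^{d_{t+1}}\to\mathbb R^{d_{t+1}}$, a matrix $W_t\in\mathbb R^{d_{t+1}\times d_t}$, a vector $b_t\in\mathbb R^{d_{t+1}}$ and matrices $P_t^{(k)}\in\mathbb C^{d_{t+1}\times d_t}$, $k\in[[K]]^d$; all activations are $C^\infty$ and globally Lipschitz. The continuum states of an input $a$ are $v_0(a)=\mathcal P\circ a$ and $$v_{t+1}(a)=\sigma_t\big(W_tv_t+\mathcal K_tv_t+b_t\big),\qquad (\mathcal K_tv)(x)=\sum_{k\in[[K]]^d}P_t^{(k)}\widehat v(k)e^{2\pi i\langle k,x\rangle};$$ the discretized states $v_t^N(a)$, defined on the grid $\{x_n\}$, satisfy the same recursion with $v_0^N(a)(x_n)=\mathcal P(a(x_n))$ and with $\mathcal K_t$ replaced by $(\mathcal K_t^Nu)(x_n)=\sum_{k\in[[K]]^d}P_t^{(k)}\mathsf{DFT}(u)(k)e^{2\pi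 i\langle k,x_n\rangle}$. (The sums are understood to be real-valued; if they are not, their coordinatewise real parts are taken.) Let $B,M\ge1$ and let $\mathcal A_c\subset H^s(\mathbb T^d,\mathbb R^{d_a})$ be compact. Then for every $t$ there is a constant $C'$, depending only on $B,M,d,s,t$ and $\mathcal A_c$, such that the following holds for every Fourier neural operator as above with $T\ge t$ layers and every $N$ with $1\le K<N/2$. Suppose that the derivatives of orders $1,\dots,s$ of $\sigma_p$, $\sigma_q$ and all $\sigma_j$ are bounded by $B$ (in operator norm), that $\big(\sum_{k\in[[K]]^d}\|P_j^{(k)}\|_F^2\big)^{1/2}\le M$, $\|W_j\|_2\le M$ and $|b_j|\le M$ for all $0\le j<T$, and that $\|A_p\|_F^2+|b_p|^2\le M^2$ and $\|A_q\|_F^2+|b_q|^2\le M^2$. Let $p_t^N(a)(x)=\sum_{k\in[[N]]^d}\mathsf{DFT}(v_t^N(a))(k)e^{2\pi i\langle k,x\rangle}$ be the trigonometric polynomial interpolating $v_t^N(a)$. Then $$\sup_{a\in\mathcal A_c}\|v_t(a)-p_t^N(a)\|_{L^2(\mathbb T^d)}\le C'N^{-s}.$$ -/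

import Mathlib

open MeasureTheory UnitAddTorus
open scoped ENNReal NNReal ContDiff

namespace FNO

noncomputable section

/-! # Vectors, the torus and its Fourier modes -/

/-- `ℝᵐ` with the Euclidean norm. -/
abbrev RVec (m : ℕ) : Type := EuclideanSpace ℝ (Fin m)

/-- `ℂᵐ` with the Euclidean (Hermitian) norm. -/
abbrev CVec (m : ℕ) : Type := EuclideanSpace ℂ (Fin m)

/-- The `d`-dimensional torus `𝕋ᵈ = (ℝ/ℤ)ᵈ`. -/
abbrev Torus (d : ℕ) : Type := UnitAddTorus (Fin d)

/-- The Lebesgue (normalized Haar) measure on `𝕋ᵈ`, i.e. the `d`-fold product of the Haar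
probability measure of `ℝ/ℤ`. It is the measure used in `mFourierCoeff`. -/
def torusMeasure (d : ℕ) : Measure (Torus d) :=
  Measure.pi fun _ => AddCircle.haarAddCircle

/-- The inclusion `ℝᵐ ⊆ ℂᵐ`. -/
def toComplex {m : ℕ} (v : RVec m) : CVec m := WithLp.toLp 2 fun i => (v i : ℂ)

/-- The coordinatewise real part `ℂᵐ → ℝᵐ`. -/
def rePart {m : ℕ} (z : CVec m) : RVec m := WithLp.toLp 2 fun i => (z i).re

/-- The Fourier coefficient `f̂(k) = ∫ f(x) e^{-2πi⟨k,x⟩} dx ∈ ℂᵐ` of `f : 𝕋ᵈ → ℝᵐ`. Its `j`-th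
coordinate is the inner product `⟨e^{2πi⟨k,·⟩}, f_j⟩` in `L²(𝕋ᵈ; ℂ)`. -/
def fourierCoeffVec {d m : ℕ} (f : Torus d → RVec m) (k : Fin d → ℤ) : CVec m :=
  mFourierCoeff (fun x => toComplex (f x)) k

/-- The index set `[[N]]`: it is `{-K, …, K}` for `N = 2K+1` and `{-K, …, K-1}` for `N = 2K`. -/
def symmIndex (N : ℕ) : Finset ℤ :=
  if Odd N then Finset.Icc (-((N / 2 : ℕ) : ℤ)) ((N / 2 : ℕ) : ℤ)
  else Finset.Ico (-((N / 2 : ℕ) : ℤ)) ((N / 2 : ℕ) : ℤ)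

/-- The index set `[[N]]ᵈ = [[N]] × … × [[N]]`. -/
def modes (d N : ℕ) : Finset (Fin d → ℤ) := Fintype.piFinset fun _ => symmIndex N

/-- The grid point `x_n = n / N ∈ 𝕋ᵈ`, for `n ∈ [N]ᵈ`. -/
def gridPoint {d N : ℕ} (n : Fin d → Fin N) : Torus d :=
  fun i => ((((n i : ℕ) : ℝ) / (N : ℝ) : ℝ) : UnitAddCircle)

/-- The discrete Fourier transform `DFT(u)(k) = N^{-d} ∑_{n ∈ [N]ᵈ} u(x_n) e^{-2πi⟨k,x_n⟩}` of
grid values `u`. -/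
def DFT {d N m : ℕ} (u : (Fin d → Fin N) → RVec m) (k : Fin d → ℤ) : CVec m :=
  ((N : ℂ) ^ d)⁻¹ • ∑ n : Fin d → Fin N, mFourier (-k) (gridPoint n) • toComplex (u n)

/-- The trigonometric polynomial `x ↦ ∑_{k ∈ [[N]]ᵈ} DFT(u)(k) e^{2πi⟨k,x⟩}` interpolating the
grid values `u`. For even `N` it can take non-real values off the grid. -/
def trigInterp {d N m : ℕ} (u : (Fin d → Fin N) → RVec m) (x : Torus d) : CVec m :=
  ∑ k ∈ modes d N, mFourier k x • DFT u k

/-! # The Sobolev space `Hˢ(𝕋ᵈ, ℝᵐ)` for `s > d/2` -/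

/-- The weight `1 + |k|^{2s}`, with `|k|` the Euclidean norm of `k ∈ ℤᵈ`. -/
def sobolevWeight {d : ℕ} (s : ℕ) (k : Fin d → ℤ) : ℝ := 1 + (∑ i, (k i : ℝ) ^ 2) ^ s

/-- The weighted Fourier coefficients `(1 + |k|^{2s})^{1/2} f̂(k)`. -/
def weightedCoeff {d m : ℕ} (s : ℕ) (f : Torus d → RVec m) (k : Fin d → ℤ) : CVec m :=
  ((Real.sqrt (sobolevWeight s k) : ℝ) : ℂ) • fourierCoeffVec f k

lemma sobolevWeight_pos {d : ℕ} (s : ℕ) (k : Fin d → ℤ) : 0 < sobolevWeight s k := by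
  unfold sobolevWeight
  positivity

lemma toComplex_add {m : ℕ} (v w : RVec m) : toComplex (v + w) = toComplex v + toComplex w := by
  ext i; simp [toComplex]

lemma toComplex_smul {m : ℕ} (c : ℝ) (v : RVec m) : toComplex (c • v) = c • toComplex v := by
  ext i; simp [toComplex]

lemma continuous_toComplex {m : ℕ} : Continuous (toComplex (m := m)) := by
  unfold toComplex; fun_prop

lemma integrable_aux {d m : ℕ} (f : C(Torus d, RVec m)) (k : Fin d → ℤ) :
    Integrable (fun x => mFourier (-k) x • toComplex (f x)) (torusMeasure d) := by
  have hc : Continuous fun x => mFourier (-k) x • toComplex (f x) :=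
    (mFourier (-k)).continuous.smul (continuous_toComplex.comp f.continuous)
  have : IsFiniteMeasure (torusMeasure d) := by unfold torusMeasure; infer_instance
  exact hc.integrable_of_hasCompactSupport (HasCompactSupport.of_compactSpace _)

lemma fourierCoeffVec_add {d m : ℕ} (f g : C(Torus d, RVec m)) (k : Fin d → ℤ) :
    fourierCoeffVec (f + g : C(Torus d, RVec m)) k
      = fourierCoeffVec f k + fourierCoeffVec g k := by
  refine Eq.trans ?_ (integral_add (μ := torusMeasure d) (integrable_aux f k)
    (integrable_aux g k))
  change ∫ x, _ ∂(torusMeasure d) = _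
  simp only [ContinuousMap.coe_add, Pi.add_apply, toComplex_add, smul_add]

lemma fourierCoeffVec_smul {d m : ℕ} (c : ℝ) (f : C(Torus d, RVec m)) (k : Fin d → ℤ) :
    fourierCoeffVec (c • f : C(Torus d, RVec m)) k = c • fourierCoeffVec f k := by
  refine Eq.trans ?_ (integral_smul (μ := torusMeasure d) c
    (fun x => mFourier (-k) x • toComplex (f x)))
  change ∫ x, _ ∂(torusMeasure d) = _
  simp only [ContinuousMap.coe_smul, Pi.smul_apply, toComplex_smul, smul_comm c]

lemma weightedCoeff_add {d m : ℕ} (s : ℕ) (f g : C(Torus d, RVec m)) :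
    weightedCoeff s (f + g : C(Torus d, RVec m)) = weightedCoeff s f + weightedCoeff s g := by
  funext k
  simp only [weightedCoeff, Pi.add_apply, fourierCoeffVec_add, smul_add]

lemma weightedCoeff_smul {d m : ℕ} (s : ℕ) (c : ℝ) (f : C(Torus d, RVec m)) :
    weightedCoeff s (c • f : C(Torus d, RVec m)) = c • weightedCoeff s f := by
  funext k
  simp only [weightedCoeff, Pi.smul_apply, fourierCoeffVec_smul, smul_comm c]

/-- `∑ₖ (1 + |k|^{2s}) |f̂(k)|² < ∞`. -/
def SobolevRegular {d m : ℕ} (s : ℕ) (f : Torus d → RVec m) : Prop :=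
  Summable fun k : Fin d → ℤ => sobolevWeight s k * ‖fourierCoeffVec f k‖ ^ 2

lemma sobolevRegular_iff {d m : ℕ} (s : ℕ) (f : Torus d → RVec m) :
    SobolevRegular s f ↔ Memℓp (weightedCoeff s f) 2 := by
  rw [memℓp_gen_iff (by norm_num)]
  unfold SobolevRegular weightedCoeff
  refine summable_congr fun k => ?_
  rw [norm_smul, ENNReal.toReal_ofNat, Real.rpow_ofNat, mul_pow, Complex.norm_real,
    Real.norm_of_nonneg (Real.sqrt_nonneg _), Real.sq_sqrt (sobolevWeight_pos s k).le]

/-- The Sobolev regular continuous functions. -/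
def sobolevSubmodule (d m s : ℕ) : Submodule ℝ C(Torus d, RVec m) where
  carrier := {f | SobolevRegular s f}
  zero_mem' := by
    have h : weightedCoeff s (0 : C(Torus d, RVec m)) = 0 := by
      have h0 : (0 : ℝ) • (0 : C(Torus d, RVec m)) = 0 := by
        ext x i; simp
      rw [← h0, weightedCoeff_smul, zero_smul]
    change SobolevRegular s _
    rw [sobolevRegular_iff, h]
    exact zero_memℓp
  add_mem' := by
    intro f g hf hg
    change SobolevRegular s _ at hf hg ⊢
    rw [sobolevRegular_iff] at hf hg ⊢
    rw [weightedCoeff_add]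
    exact hf.add hg
  smul_mem' := by
    intro c f hf
    change SobolevRegular s _ at hf ⊢
    rw [sobolevRegular_iff] at hf ⊢
    rw [weightedCoeff_smul]
    exact hf.const_smul c

/-- The Sobolev space `Hˢ(𝕋ᵈ, ℝᵐ)`, for integers `s > d/2`. In this range each class of functions
with `∑ₖ (1 + |k|^{2s}) |f̂(k)|² < ∞` has exactly one continuous representative, so the space is
realized as a space of continuous functions; its elements have values at grid points. -/
def SobolevSpace (d m s : ℕ) : Type := sobolevSubmodule d m s

/-- The continuous function underlying an element of the Sobolev space. -/
def SobolevSpace.toFun {d m s : ℕ} (f : SobolevSpace d m s) : Torus d → RVec m := ⇑f.1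

instance (d m s : ℕ) : AddCommGroup (SobolevSpace d m s) :=
  inferInstanceAs (AddCommGroup (sobolevSubmodule d m s))

instance (d m s : ℕ) : Module ℝ (SobolevSpace d m s) :=
  inferInstanceAs (Module ℝ (sobolevSubmodule d m s))

/-- The embedding `f ↦ ((1 + |k|^{2s})^{1/2} f̂(k))ₖ` of the Sobolev space into `ℓ²(ℤᵈ, ℂᵐ)`. -/
def sobolevToLp (d m s : ℕ) :
    SobolevSpace d m s →ₗ[ℝ] lp (fun _ : Fin d → ℤ => CVec m) 2 where
  toFun f := ⟨weightedCoeff s f.toFun, (sobolevRegular_iff s f.toFun).1 f.2⟩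
  map_add' f g := Subtype.ext (weightedCoeff_add s f.1 g.1)
  map_smul' c f := Subtype.ext (weightedCoeff_smul s c f.1)

lemma fourierCoeffVec_apply {d m : ℕ} (f : C(Torus d, RVec m)) (k : Fin d → ℤ) (i : Fin m) :
    fourierCoeffVec f k i = mFourierCoeff (fun x => ((f x i : ℝ) : ℂ)) k :=
  ((EuclideanSpace.proj (𝕜 := ℂ) i).integral_comp_comm (integrable_aux f k)).symm

lemma sobolevToLp_injective (d m s : ℕ) : Function.Injective (sobolevToLp d m s) := by
  rw [injective_iff_map_eq_zero]
  intro f hf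
  have h0 : ∀ k, fourierCoeffVec f.1 k = 0 := by
    intro k
    have h1 : weightedCoeff s f.1 k = 0 := congrFun (congrArg Subtype.val hf) k
    have h2 : ((Real.sqrt (sobolevWeight s k) : ℝ) : ℂ) ≠ 0 := by
      exact_mod_cast (Real.sqrt_pos.2 (sobolevWeight_pos s k)).ne'
    exact (smul_eq_zero.1 h1).resolve_left h2
  refine Subtype.ext (ContinuousMap.ext fun x => ?_)
  ext i
  let g : C(Torus d, ℂ) := ⟨fun x => ((f.1 x i : ℝ) : ℂ), by fun_prop⟩
  have hg : mFourierCoeff g = 0 := by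
    funext k
    have h3 := fourierCoeffVec_apply f.1 k i
    rw [h0 k] at h3
    exact h3.symm
  have hs := hasSum_mFourier_series_apply_of_summable (f := g) (by rw [hg]; exact summable_zero) x
  simp only [hg, Pi.zero_apply, zero_smul] at hs
  have h4 : ((f.1 x i : ℝ) : ℂ) = 0 := hs.unique hasSum_zero
  exact Complex.ofReal_eq_zero.1 h4

/-- The Sobolev norm `‖f‖_{Hˢ} = (∑ₖ (1 + |k|^{2s}) |f̂(k)|²)^{1/2}`. -/
instance (d m s : ℕ) : NormedAddCommGroup (SobolevSpace d m s) :=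
  NormedAddCommGroup.induced (SobolevSpace d m s) (lp (fun _ : Fin d → ℤ => CVec m) 2)
    (sobolevToLp d m s) (sobolevToLp_injective d m s)

lemma SobolevSpace.norm_sq_eq {d m s : ℕ} (f : SobolevSpace d m s) :
    ‖f‖ ^ 2 = ∑' k : Fin d → ℤ, sobolevWeight s k * ‖fourierCoeffVec f.toFun k‖ ^ 2 := by
  have h1 : ‖f‖ = ‖sobolevToLp d m s f‖ := rfl
  have h2 := lp.norm_rpow_eq_tsum (p := 2) (by norm_num) (sobolevToLp d m s f)
  rw [ENNReal.toReal_ofNat, Real.rpow_ofNat] at h2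
  rw [h1, h2]
  refine tsum_congr fun k => ?_
  change ‖weightedCoeff s f.toFun k‖ ^ (2 : ℝ) = _
  rw [weightedCoeff, norm_smul, Real.rpow_ofNat, mul_pow, Complex.norm_real,
    Real.norm_of_nonneg (Real.sqrt_nonneg _), Real.sq_sqrt (sobolevWeight_pos s k).le]

/-! # Matrix norms and shallow networks -/

/-- The squared Frobenius norm of a real or complex matrix. -/
def frobSq {𝕜 : Type*} [RCLike 𝕜] {m n : ℕ} (A : Matrix (Fin m) (Fin n) 𝕜) : ℝ :=
  ∑ i, ∑ j, ‖A i j‖ ^ 2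

open scoped Matrix.Norms.L2Operator in
/-- The matrix norm induced by the Euclidean norms. -/
def induced2Norm {m n : ℕ} (A : Matrix (Fin m) (Fin n) ℝ) : ℝ := ‖A‖

/-- The action of a matrix on Euclidean vectors. -/
def matVec {𝕜 : Type*} [RCLike 𝕜] {m n : ℕ} (A : Matrix (Fin m) (Fin n) 𝕜)
    (v : EuclideanSpace 𝕜 (Fin n)) : EuclideanSpace 𝕜 (Fin m) :=
  WithLp.toLp 2 (A.mulVec v.ofLp)

/-- An activation function: a smooth, globally Lipschitz map of `ℝᵐ` to itself. -/
structure Activation (m : ℕ) where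
  /-- the map -/
  map : RVec m → RVec m
  smooth : ContDiff ℝ ∞ map
  lipschitz : ∃ L : ℝ≥0, LipschitzWith L map

/-- The derivatives of `σ` of orders `1, …, s` are bounded by `B` (in the operator norm of
multilinear maps between Euclidean spaces). The values of `σ` itself may be unbounded. -/
def DerivBounded {m : ℕ} (σ : Activation m) (s : ℕ) (B : ℝ) : Prop :=
  ∀ j : ℕ, 1 ≤ j → j ≤ s → ∀ x, ‖iteratedFDeriv ℝ j σ.map x‖ ≤ B

/-- A shallow neural network `φ(u) = σ(A u + b)`. -/
structure ShallowNet (m n : ℕ) where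
  /-- the weight matrix -/
  A : Matrix (Fin n) (Fin m) ℝ
  /-- the bias -/
  b : RVec n
  /-- the activation -/
  act : Activation n

/-- The map computed by a shallow network. -/
def ShallowNet.eval {m n : ℕ} (φ : ShallowNet m n) (u : RVec m) : RVec n :=
  φ.act.map (matVec φ.A u + φ.b)

/-- `‖φ‖_NN = (‖A‖_F² + |b|²)^{1/2}`. -/
def ShallowNet.nnNorm {m n : ℕ} (φ : ShallowNet m n) : ℝ :=
  Real.sqrt (frobSq φ.A + ‖φ.b‖ ^ 2)

/-! # The Fourier neural operator -/

/-- The hyperparameters and parameters of a Fourier neural operator on `𝕋ᵈ` with `T` layers, from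
`ℝ^{da}`-valued functions to `ℝ^{du}`-valued functions. -/
structure FourierNeuralOperator (d da du T : ℕ) where
  /-- the channel dimensions `d₀, …, d_T` -/
  width : Fin (T + 1) → ℕ
  /-- the mode truncation parameter -/
  K : ℕ
  /-- the lifting network `𝒫` -/
  lift : ShallowNet da (width 0)
  /-- the projection network `𝒬` -/
  proj : ShallowNet (width (Fin.last T)) du
  /-- the activations `σ_t` -/
  σ : (t : Fin T) → Activation (width t.succ)
  /-- the weights `W_t` -/
  W : (t : Fin T) → Matrix (Fin (width t.succ)) (Fin (width t.castSucc)) ℝ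
  /-- the biases `b_t` -/
  b : (t : Fin T) → RVec (width t.succ)
  /-- the kernel weights `P_t^{(k)}`; only those with `k ∈ [[K]]ᵈ` are used -/
  P : (t : Fin T) → (Fin d → ℤ) → Matrix (Fin (width t.succ)) (Fin (width t.castSucc)) ℂ

namespace FourierNeuralOperator

variable {d da du T : ℕ} (Φ : FourierNeuralOperator d da du T)

/-- The sum `∑_{k ∈ [[K]]ᵈ} P_t^{(k)} c(k) e^{2πi⟨k,x⟩}`, as a real vector. For kernel weights for
which the sum is real, as is usually required, the real part does nothing. -/
def modeSum (t : Fin T) (c : (Fin d → ℤ) → CVec (Φ.width t.castSucc)) (x : Torus d) :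
    RVec (Φ.width t.succ) :=
  rePart (∑ k ∈ modes d Φ.K, mFourier k x • matVec (Φ.P t k) (c k))

/-- The integral kernel operator `𝒦_t`, using the Fourier coefficients of `v`. -/
def kernel (t : Fin T) (v : Torus d → RVec (Φ.width t.castSucc)) :
    Torus d → RVec (Φ.width t.succ) :=
  Φ.modeSum t (fourierCoeffVec v)

/-- The discretized kernel operator `𝒦_t^N`, using the DFT of the grid values `u`, on the grid. -/
def kernelN {N : ℕ} (t : Fin T) (u : (Fin d → Fin N) → RVec (Φ.width t.castSucc)) :
    (Fin d → Fin N) → RVec (Φ.width t.succ) :=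
  fun n => Φ.modeSum t (DFT u) (gridPoint n)

/-- The layer `L_t v = σ_t(W_t v + 𝒦_t v + b_t)`. -/
def layer (t : Fin T) (v : Torus d → RVec (Φ.width t.castSucc)) :
    Torus d → RVec (Φ.width t.succ) :=
  fun x => (Φ.σ t).map (matVec (Φ.W t) (v x) + Φ.kernel t v x + Φ.b t)

/-- The discretized layer `L_t^N u = σ_t(W_t u + 𝒦_t^N u + b_t)` acting on grid values. -/
def layerN {N : ℕ} (t : Fin T) (u : (Fin d → Fin N) → RVec (Φ.width t.castSucc)) :
    (Fin d → Fin N) → RVec (Φ.width t.succ) :=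
  fun n => (Φ.σ t).map (matVec (Φ.W t) (u n) + Φ.kernelN t u n + Φ.b t)

/-- The continuum state `v_t(a) = L_{t-1} ∘ ⋯ ∘ L_0 ∘ 𝒫 (a)`, for `0 ≤ t ≤ T`. -/
def state (a : Torus d → RVec da) (t : Fin (T + 1)) : Torus d → RVec (Φ.width t) :=
  Fin.induction (motive := fun t => Torus d → RVec (Φ.width t))
    (fun x => Φ.lift.eval (a x)) (fun t v => Φ.layer t v) t

/-- The discretized state `v_t^N(a) = L_{t-1}^N ∘ ⋯ ∘ L_0^N ∘ 𝒫 (a)` on the grid, `0 ≤ t ≤ T`. -/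
def stateN (N : ℕ) (a : Torus d → RVec da) (t : Fin (T + 1)) :
    (Fin d → Fin N) → RVec (Φ.width t) :=
  Fin.induction (motive := fun t => (Fin d → Fin N) → RVec (Φ.width t))
    (fun n => Φ.lift.eval (a (gridPoint n))) (fun t u => Φ.layerN t u) t

/-- The operator `Ψ = 𝒬 ∘ L_{T-1} ∘ ⋯ ∘ L_0 ∘ 𝒫`. -/
def eval (a : Torus d → RVec da) : Torus d → RVec du :=
  fun x => Φ.proj.eval (Φ.state a (Fin.last T) x)

/-- The tensor Frobenius norm `‖P_t‖_F = (∑_{k ∈ [[K]]ᵈ} ‖P_t^{(k)}‖_F²)^{1/2}`. -/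
def kernelFrobNorm (t : Fin T) : ℝ := Real.sqrt (∑ k ∈ modes d Φ.K, frobSq (Φ.P t k))

/-- The standing bounds on a Fourier neural operator: derivatives of the activations up to order
`s` are bounded by `B`, and the parameters are bounded by `M`. -/
structure Bounded (s : ℕ) (B M : ℝ) : Prop where
  deriv_σ : ∀ t, DerivBounded (Φ.σ t) s B
  deriv_lift : DerivBounded Φ.lift.act s B
  deriv_proj : DerivBounded Φ.proj.act s B
  norm_P : ∀ t, Φ.kernelFrobNorm t ≤ M
  norm_W : ∀ t, induced2Norm (Φ.W t) ≤ M
  norm_b : ∀ t, ‖Φ.b t‖ ≤ M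
  norm_lift : Φ.lift.nnNorm ≤ M
  norm_proj : Φ.proj.nnNorm ≤ M

end FourierNeuralOperator

end

end FNO

namespace FNO

noncomputable section

/-! # Integration and Fourier coefficients on the torus -/

/-! The proof needs a bound on the homogeneous seminorm (∑ |k|^{2s} |f̂(k)|²)^{1/2} of every
continuum state, uniform over all networks within the bounds. Given this, the discretization error
is a matter of aliasing. The activations may be unbounded, and widths may vary, so only the
homogeneous seminorm is used: it ignores constants, and no estimate depends on the channel
dimensions.

Regularity. Matrices and Fourier multipliers multiply the seminorm by at most `M`, and biases leave
it unchanged. The activation is treated by `SeminormLE.comp`. Along one coordinate, Faà di Bruno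
bounds the `s`-th derivative of σ ∘ u by products of derivatives ∂^a u with orders adding up to `s`.
These products lie in L² because ∂^a u lies in L^{2s/a}, by Gagliardo–Nirenberg
(`gagliardoNirenberg`) between the bound on u in L^∞ and that on ∂^s u in L². Since s > d/2,
Cauchy–Schwarz against the lattice sum bounds u minus its mean in L^∞ by the seminorm; the mean is
absorbed into a translation of σ. The estimate is proved for trigonometric polynomials and passes to
the limit, which is easy because `SeminormLE` speaks of finite sums of coefficients.

Discretization. The DFT of a function at `k` is the sum of its Fourier coefficients over k + Nℤ^d
(`hasSum_DFT`). Weighted Cauchy–Schwarz makes the ℓ² aliasing error O(N^{-s}) (`sum_aliasing_le`),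
and modes outside [[N]]^d contribute O(N^{-s}) as well. In the normalized ℓ² norm on the grid, a
layer multiplies the error already present by a constant and adds an aliasing error
(`gridSq_layer_sub_le`), so induction on the layers gives O(N^{-s}) on the grid (`state_bounds`).
Parseval turns this into the L² bound for the interpolant (`integral_norm_sq_sub_trigInterp_le`). -/

instance isProbabilityMeasure_torusMeasure (d : ℕ) : IsProbabilityMeasure (torusMeasure d) := by
  unfold torusMeasure; infer_instance

instance isAddRightInvariant_torusMeasure (d : ℕ) : (torusMeasure d).IsAddRightInvariant := by
  unfold torusMeasure; infer_instance

lemma integrable_of_continuous {d : ℕ} {E : Type*} [NormedAddCommGroup E]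
    {g : Torus d → E} (hg : Continuous g) : Integrable g (torusMeasure d) :=
  hg.integrable_of_hasCompactSupport (HasCompactSupport.of_compactSpace _)

lemma mFourierCoeff_eq {d : ℕ} {E : Type*} [NormedAddCommGroup E] [NormedSpace ℂ E]
    (g : Torus d → E) (k : Fin d → ℤ) :
    mFourierCoeff g k = ∫ x, mFourier (-k) x • g x ∂(torusMeasure d) := rfl

lemma norm_mFourier_apply {d : ℕ} (k : Fin d → ℤ) (x : Torus d) : ‖mFourier k x‖ = 1 := by
  simp [mFourier, norm_prod, Circle.norm_coe]

lemma continuous_mFourier_smul {d : ℕ} {E : Type*} [NormedAddCommGroup E] [NormedSpace ℂ E]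
    {g : Torus d → E} (hg : Continuous g) (k : Fin d → ℤ) :
    Continuous fun x => mFourier k x • g x := (mFourier k).continuous.smul hg

lemma mFourierCoeff_add_fun {d : ℕ} {E : Type*} [NormedAddCommGroup E] [NormedSpace ℂ E]
    {f g : Torus d → E} (hf : Continuous f) (hg : Continuous g) (k : Fin d → ℤ) :
    mFourierCoeff (fun x => f x + g x) k = mFourierCoeff f k + mFourierCoeff g k := by
  simp only [mFourierCoeff_eq, smul_add]
  exact integral_add (integrable_of_continuous (continuous_mFourier_smul hf _))
    (integrable_of_continuous (continuous_mFourier_smul hg _))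

lemma mFourierCoeff_sub_fun {d : ℕ} {E : Type*} [NormedAddCommGroup E] [NormedSpace ℂ E]
    {f g : Torus d → E} (hf : Continuous f) (hg : Continuous g) (k : Fin d → ℤ) :
    mFourierCoeff (fun x => f x - g x) k = mFourierCoeff f k - mFourierCoeff g k := by
  simp only [mFourierCoeff_eq, smul_sub]
  exact integral_sub (integrable_of_continuous (continuous_mFourier_smul hf _))
    (integrable_of_continuous (continuous_mFourier_smul hg _))

lemma mFourierCoeff_sum_fun {d : ℕ} {E : Type*} [NormedAddCommGroup E] [NormedSpace ℂ E]
    {ι : Type*} (S : Finset ι) {f : ι → Torus d → E} (hf : ∀ i, Continuous (f i))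
    (k : Fin d → ℤ) :
    mFourierCoeff (fun x => ∑ i ∈ S, f i x) k = ∑ i ∈ S, mFourierCoeff (f i) k := by
  simp only [mFourierCoeff_eq, Finset.smul_sum]
  exact integral_finsetSum _ fun i _ =>
    integrable_of_continuous (continuous_mFourier_smul (hf i) _)

lemma norm_mFourierCoeff_le {d : ℕ} {E : Type*} [NormedAddCommGroup E] [NormedSpace ℂ E]
    {g : Torus d → E} {C : ℝ} (hC : ∀ x, ‖g x‖ ≤ C) (k : Fin d → ℤ) :
    ‖mFourierCoeff g k‖ ≤ C := by
  rw [mFourierCoeff_eq]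
  refine (norm_integral_le_of_norm_le_const (C := C) (Filter.Eventually.of_forall fun x => ?_)).trans
    (by simp)
  rw [norm_smul, norm_mFourier_apply, one_mul]
  exact hC x

lemma integral_mFourier {d : ℕ} (k : Fin d → ℤ) :
    ∫ x, mFourier k x ∂(torusMeasure d) = if k = 0 then 1 else 0 := by
  have h := orthonormal_iff_ite.1 (orthonormal_mFourier (d := Fin d)) 0 k
  simp only [ContinuousMap.inner_toLp, mFourier_zero, ContinuousMap.one_apply, map_one, mul_one,
    @eq_comm _ 0 k] at h
  exact h

lemma mFourierCoeff_mFourier_smul {d : ℕ} {E : Type*} [NormedAddCommGroup E] [NormedSpace ℂ E]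
    [CompleteSpace E] (j : Fin d → ℤ) (c : E) (k : Fin d → ℤ) :
    mFourierCoeff (fun x => mFourier j x • c) k = if j = k then c else 0 := by
  simp only [mFourierCoeff_eq, smul_smul, ← mFourier_add]
  rw [integral_smul_const, integral_mFourier]
  by_cases h : j = k
  · simp [h]
  · rw [if_neg h, if_neg, zero_smul]
    intro h'
    exact h (by rw [← sub_eq_zero, ← h']; abel)

lemma mFourierCoeff_apply {d m : ℕ} {g : Torus d → CVec m} (hg : Continuous g)
    (k : Fin d → ℤ) (j : Fin m) :
    mFourierCoeff g k j = mFourierCoeff (fun x => g x j) k :=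
  ((EuclideanSpace.proj (𝕜 := ℂ) j).integral_comp_comm
    (integrable_of_continuous (continuous_mFourier_smul hg (-k)))).symm

lemma hasSum_sq_mFourierCoeff_scalar {d : ℕ} {g : Torus d → ℂ} (hg : Continuous g) :
    HasSum (fun k => ‖mFourierCoeff g k‖ ^ 2) (∫ x, ‖g x‖ ^ 2 ∂(torusMeasure d)) := by
  have h := hasSum_sq_mFourierCoeff (ContinuousMap.toLp (E := ℂ) 2 (torusMeasure d) ℂ ⟨g, hg⟩)
  have h1 : ∀ k, mFourierCoeff (ContinuousMap.toLp (E := ℂ) 2 (torusMeasure d) ℂ ⟨g, hg⟩) k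
      = mFourierCoeff g k := mFourierCoeff_toLp (⟨g, hg⟩ : C(Torus d, ℂ))
  have h2 : ∫ x, ‖ContinuousMap.toLp (E := ℂ) 2 (torusMeasure d) ℂ ⟨g, hg⟩ x‖ ^ 2 ∂(torusMeasure d)
      = ∫ x, ‖g x‖ ^ 2 ∂(torusMeasure d) := by
    refine integral_congr_ae ?_
    filter_upwards [ContinuousMap.coeFn_toLp (E := ℂ) (p := 2) (torusMeasure d) (𝕜 := ℂ) ⟨g, hg⟩]
      with x hx
    rw [hx]; rfl
  rw [← h2, show (fun k => ‖mFourierCoeff g k‖ ^ 2) = fun k =>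
    ‖mFourierCoeff (ContinuousMap.toLp (E := ℂ) 2 (torusMeasure d) ℂ ⟨g, hg⟩) k‖ ^ 2 from
    funext fun k => by rw [h1 k]]
  exact h

/-- Parseval's identity for continuous vector-valued functions. -/
lemma parseval {d m : ℕ} {g : Torus d → CVec m} (hg : Continuous g) :
    HasSum (fun k => ‖mFourierCoeff g k‖ ^ 2) (∫ x, ‖g x‖ ^ 2 ∂(torusMeasure d)) := by
  have hj : ∀ j, Continuous fun x => g x j := fun j => by fun_prop
  simp only [EuclideanSpace.norm_sq_eq, mFourierCoeff_apply hg]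
  rw [integral_finsetSum (f := fun j x => ‖g x j‖ ^ 2) _
    fun j _ => integrable_of_continuous ((hj j).norm.pow 2)]
  exact hasSum_sum fun j _ => hasSum_sq_mFourierCoeff_scalar (hj j)

lemma eLpNorm_two_eq {d m : ℕ} {g : Torus d → CVec m} (hg : Continuous g) :
    eLpNorm g 2 (torusMeasure d)
      = ENNReal.ofReal (Real.sqrt (∫ x, ‖g x‖ ^ 2 ∂(torusMeasure d))) := by
  have hL : MemLp g 2 (torusMeasure d) :=
    hg.memLp_of_hasCompactSupport (HasCompactSupport.of_compactSpace _)
  rw [hL.eLpNorm_eq_integral_rpow_norm (by norm_num) (by norm_num)]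
  simp [Real.sqrt_eq_rpow]

/-! # Directional derivatives on the torus -/

/-- The point `t eᵢ` of the torus. -/
def axisShift {d : ℕ} (i : Fin d) (t : ℝ) : Torus d := Pi.single i (t : UnitAddCircle)

lemma continuous_axisShift {d : ℕ} (i : Fin d) : Continuous (axisShift i) :=
  (continuous_single i).comp (AddCircle.continuous_mk' 1)

lemma axisShift_zero {d : ℕ} (i : Fin d) : axisShift i 0 = 0 := by
  simp [axisShift]

lemma axisShift_one {d : ℕ} (i : Fin d) : axisShift i 1 = 0 := by
  have : ((1 : ℝ) : UnitAddCircle) = 0 := AddCircle.coe_period 1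
  simp [axisShift, this]

lemma axisShift_add {d : ℕ} (i : Fin d) (s t : ℝ) :
    axisShift i (s + t) = axisShift i s + axisShift i t := by
  simp [axisShift, ← Pi.single_add]

lemma mFourier_add_axisShift {d : ℕ} (k : Fin d → ℤ) (x : Torus d) (i : Fin d) (t : ℝ) :
    mFourier k (x + axisShift i t)
      = Complex.exp (2 * Real.pi * Complex.I * k i * t) * mFourier k x := by
  have h1 : ∀ y z : Torus d, mFourier k (y + z) = mFourier k y * mFourier k z := by
    intro y z
    simp only [mFourier, ContinuousMap.coe_mk, Pi.add_apply,
      ← Finset.prod_mul_distrib]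
    refine Finset.prod_congr rfl fun j _ => ?_
    simp [fourier_apply, smul_add, AddCircle.toCircle_add]
  rw [h1, mul_comm]
  congr 1
  simp only [mFourier, ContinuousMap.coe_mk, axisShift]
  rw [Finset.prod_eq_single i]
  · rw [Pi.single_eq_same, fourier_coe_apply]
    simp
  · intro j _ hj
    rw [Pi.single_eq_of_ne hj]
    exact fourier_eval_zero _
  · simp

/-- `g'` is the derivative of `g` in the `i`-th coordinate direction. -/
def HasAxisDeriv {d : ℕ} {E : Type*} [NormedAddCommGroup E] [NormedSpace ℝ E]
    (i : Fin d) (g g' : Torus d → E) : Prop :=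
  ∀ x, HasDerivAt (fun t : ℝ => g (x + axisShift i t)) (g' x) 0

lemma HasAxisDeriv.hasDerivAt {d : ℕ} {E : Type*} [NormedAddCommGroup E] [NormedSpace ℝ E]
    {i : Fin d} {g g' : Torus d → E} (h : HasAxisDeriv i g g') (x : Torus d) (t : ℝ) :
    HasDerivAt (fun t : ℝ => g (x + axisShift i t)) (g' (x + axisShift i t)) t := by
  have h1 := h (x + axisShift i t)
  rw [← sub_self t] at h1
  have h2 := h1.comp_sub_const t t
  refine h2.congr_of_eventuallyEq (Filter.Eventually.of_forall fun r => ?_)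
  change g _ = g _
  rw [add_assoc, ← axisShift_add]
  congr 3; ring

/-- Average over t ∈ [0,1] the integral of g'(x + t eᵢ). Translation invariance makes it independent
of t, while Fubini and the fundamental theorem of calculus on the closed loop t ↦ x + t eᵢ give
zero. -/
lemma integral_axisDeriv_eq_zero {d : ℕ} {E : Type*} [NormedAddCommGroup E] [NormedSpace ℝ E]
    [CompleteSpace E] {i : Fin d} {g g' : Torus d → E} (hg' : Continuous g')
    (h : HasAxisDeriv i g g') : ∫ x, g' x ∂(torusMeasure d) = 0 := by
  have hc : Continuous (Function.uncurry fun (x : Torus d) (t : ℝ) => g' (x + axisShift i t)) :=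
    hg'.comp (continuous_fst.add ((continuous_axisShift i).comp continuous_snd))
  have h1 : ∀ x, ∫ t in (0 : ℝ)..1, g' (x + axisShift i t) = 0 := by
    intro x
    rw [intervalIntegral.integral_eq_sub_of_hasDerivAt (fun t _ => h.hasDerivAt x t)
      ((hc.comp (Continuous.prodMk_right x)).intervalIntegrable _ _)]
    simp [axisShift_zero, axisShift_one]
  have h2 : ∫ t in (0 : ℝ)..1, (∫ x, g' (x + axisShift i t) ∂(torusMeasure d)) = 0 := by
    rw [intervalIntegral.integral_of_le zero_le_one, integral_integral_swap]
    · simp only [intervalIntegral.integral_of_le (zero_le_one (α := ℝ))] at h1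
      simp [h1]
    · have hc2 : Continuous (Function.uncurry fun (t : ℝ) (x : Torus d) =>
          g' (x + axisShift i t)) := hc.comp continuous_swap
      obtain ⟨C, hC⟩ := (isCompact_range hg').isBounded.exists_norm_le
      refine Integrable.of_bound (C := C) ?_ (Filter.Eventually.of_forall fun z => ?_)
      · exact hc2.aestronglyMeasurable
      · exact hC _ ⟨_, rfl⟩
  simp only [integral_add_right_eq_self] at h2
  simpa using h2

/-- Integration by parts: the derivative of e^{-2πi⟨k,x⟩} g(x) has mean zero. -/
lemma mFourierCoeff_axisDeriv {d : ℕ} {E : Type*} [NormedAddCommGroup E] [NormedSpace ℂ E]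
    [CompleteSpace E] {i : Fin d} {g g' : Torus d → E} (hg : Continuous g) (hg' : Continuous g')
    (h : HasAxisDeriv i g g') (k : Fin d → ℤ) :
    mFourierCoeff g' k = (2 * Real.pi * Complex.I * k i : ℂ) • mFourierCoeff g k := by
  set c : ℂ := 2 * Real.pi * Complex.I * k i with hcdef
  have hd : HasAxisDeriv i (fun x => mFourier (-k) x • g x)
      (fun x => mFourier (-k) x • g' x - c • mFourier (-k) x • g x) := by
    intro x
    have h1 : HasDerivAt (fun t : ℝ => mFourier (-k) (x + axisShift i t))
        (-c * mFourier (-k) x) 0 := by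
      simp only [mFourier_add_axisShift]
      refine HasDerivAt.mul_const ?_ _
      have h2 : HasDerivAt (fun t : ℝ => (2 * Real.pi * Complex.I * ((-k) i : ℤ) * (t : ℂ)))
          (2 * Real.pi * Complex.I * ((-k) i : ℤ) * 1) 0 :=
        (Complex.ofRealCLM.hasDerivAt (x := (0 : ℝ))).const_mul _
      have h3 := h2.cexp
      convert! h3 using 1
      simp [hcdef]
    have h4 := h1.smul (h x)
    convert! h4 using 1
    simp only [axisShift_zero, add_zero, smul_smul, neg_mul, neg_smul]
    rw [sub_eq_add_neg]
  have h0 := integral_axisDeriv_eq_zero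
    ((continuous_mFourier_smul hg' _).sub ((continuous_mFourier_smul hg (-k)).const_smul c)) hd
  change ∫ x, (mFourier (-k) x • g' x - c • mFourier (-k) x • g x) ∂(torusMeasure d) = 0 at h0
  rw [integral_sub (g := fun x => c • mFourier (-k) x • g x)
    (integrable_of_continuous (continuous_mFourier_smul hg' _))
    (integrable_of_continuous ((continuous_mFourier_smul hg (-k)).const_smul c)),
    integral_smul, sub_eq_zero] at h0
  exact h0

/-! # Gagliardo–Nirenberg interpolation in a coordinate direction -/

section GagliardoNirenberg

variable {d : ℕ} {V : Type*} [NormedAddCommGroup V] [InnerProductSpace ℝ V] {i : Fin d}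

open scoped RealInnerProductSpace

/-- This is |v|^{2q} ⟨u, v⟩ regularized by `ε`, since |v|^{2q} need not be differentiable where v
vanishes. Its derivative has mean zero, which is the integration by parts behind the interpolation
inequality. -/
lemma HasAxisDeriv.rpow_mul_inner {u v w : Torus d → V} (huv : HasAxisDeriv i u v)
    (hvw : HasAxisDeriv i v w) (q : ℝ) {ε : ℝ} (hε : 0 < ε) :
    HasAxisDeriv i (fun x => (ε + ‖v x‖ ^ 2) ^ q * ⟪u x, v x⟫)
      (fun x => 2 * ⟪v x, w x⟫ * q * (ε + ‖v x‖ ^ 2) ^ (q - 1) * ⟪u x, v x⟫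
        + (ε + ‖v x‖ ^ 2) ^ q * (⟪u x, w x⟫ + ⟪v x, v x⟫)) := by
  intro x
  have hu := huv x
  have hv := hvw x
  have h1 := (hv.norm_sq.const_add ε).rpow_const (p := q)
    (Or.inl (by positivity))
  have h2 := h1.mul (hu.inner ℝ hv)
  convert! h2 using 1
  simp [axisShift_zero]

lemma integral_regularized_le {u v w : Torus d → V} (hu : Continuous u) (hv : Continuous v)
    (hw : Continuous w) (huv : HasAxisDeriv i u v) (hvw : HasAxisDeriv i v w) {q : ℝ}
    (hq : 0 < q) {ε : ℝ} (hε : 0 < ε) :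
    ∫ x, (ε + ‖v x‖ ^ 2) ^ q * (‖v x‖ ^ 2 - (2 * q + 1) * (‖u x‖ * ‖w x‖)) ∂(torusMeasure d)
      ≤ 0 := by
  have hX : ∀ x, 0 < ε + ‖v x‖ ^ 2 := fun x => by positivity
  have hpow : ∀ r : ℝ, Continuous fun x => (ε + ‖v x‖ ^ 2) ^ r := fun r =>
    (continuous_const.add (hv.norm.pow 2)).rpow_const fun x => Or.inl (hX x).ne'
  have hG' : Continuous (fun x => 2 * ⟪v x, w x⟫ * q * (ε + ‖v x‖ ^ 2) ^ (q - 1) * ⟪u x, v x⟫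
        + (ε + ‖v x‖ ^ 2) ^ q * (⟪u x, w x⟫ + ⟪v x, v x⟫)) := by
    have := hpow q
    have := hpow (q - 1)
    fun_prop
  rw [← integral_axisDeriv_eq_zero hG' (huv.rpow_mul_inner hvw q hε)]
  refine integral_mono (integrable_of_continuous ?_) (integrable_of_continuous hG') fun x => ?_
  · have := hpow q
    fun_prop
  have h1 : (ε + ‖v x‖ ^ 2) ^ q = (ε + ‖v x‖ ^ 2) ^ (q - 1) * (ε + ‖v x‖ ^ 2) := by
    rw [← Real.rpow_add_one (hX x).ne', sub_add_cancel]
  have hP : 0 < (ε + ‖v x‖ ^ 2) ^ (q - 1) := Real.rpow_pos_of_pos (hX x) _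
  simp only [real_inner_self_eq_norm_sq, h1]
  set P := (ε + ‖v x‖ ^ 2) ^ (q - 1)
  have a1 : -(‖u x‖ * ‖w x‖) ≤ ⟪u x, w x⟫ := neg_le_of_abs_le (abs_real_inner_le_norm _ _)
  have a2 : -(‖v x‖ ^ 2 * (‖u x‖ * ‖w x‖)) ≤ ⟪v x, w x⟫ * ⟪u x, v x⟫ := by
    refine neg_le_of_abs_le ?_
    rw [abs_mul]
    calc |⟪v x, w x⟫| * |⟪u x, v x⟫| ≤ (‖v x‖ * ‖w x‖) * (‖u x‖ * ‖v x‖) :=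
          mul_le_mul (abs_real_inner_le_norm _ _) (abs_real_inner_le_norm _ _) (abs_nonneg _)
            (by positivity)
      _ = _ := by ring
  have hUW : 0 ≤ ‖u x‖ * ‖w x‖ := by positivity
  set UW := ‖u x‖ * ‖w x‖
  -- The right side minus the left side is exactly the sum of the three nonnegative terms `b1`,
  -- `b2`, `b3`.
  have b1 : 0 ≤ P * (ε + ‖v x‖ ^ 2) * (⟪u x, w x⟫ + UW) :=
    mul_nonneg (mul_pos hP (hX x)).le (by linarith)
  have b2 : 0 ≤ P * (2 * q) * (⟪v x, w x⟫ * ⟪u x, v x⟫ + ‖v x‖ ^ 2 * UW) :=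
    mul_nonneg (by positivity) (by linarith)
  have b3 : 0 ≤ P * (2 * q) * (ε * UW) := by positivity
  nlinarith

lemma integral_norm_rpow_le {u v w : Torus d → V} (hu : Continuous u) (hv : Continuous v)
    (hw : Continuous w) (huv : HasAxisDeriv i u v) (hvw : HasAxisDeriv i v w) {q : ℝ}
    (hq : 0 < q) :
    ∫ x, ‖v x‖ ^ (2 * q + 2) ∂(torusMeasure d)
      ≤ (2 * q + 1) * ∫ x, ‖u x‖ * ‖v x‖ ^ (2 * q) * ‖w x‖ ∂(torusMeasure d) := by
  -- The absolute value makes the family continuous for all real `ε`, so that ε → 0⁺ is a limit at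
  -- an interior point.
  let F : ℝ → Torus d → ℝ := fun ε x =>
    (|ε| + ‖v x‖ ^ 2) ^ q * (‖v x‖ ^ 2 - (2 * q + 1) * (‖u x‖ * ‖w x‖))
  have hF : Continuous F.uncurry := by
    have h1 : Continuous fun z : ℝ × Torus d => (|z.1| + ‖v z.2‖ ^ 2) ^ q :=
      (by fun_prop : Continuous fun z : ℝ × Torus d => |z.1| + ‖v z.2‖ ^ 2).rpow_const
        fun _ => Or.inr hq.le
    exact h1.mul (by fun_prop)
  have hc : Continuous fun ε => ∫ x in Set.univ, F ε x ∂(torusMeasure d) :=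
    continuous_parametric_integral_of_continuous hF isCompact_univ
  simp only [setIntegral_univ] at hc
  have h0 : ∫ x, F 0 x ∂(torusMeasure d) ≤ 0 := by
    refine le_of_tendsto (hc.tendsto 0 |>.mono_left (nhdsWithin_le_nhds (s := Set.Ioi 0))) ?_
    filter_upwards [self_mem_nhdsWithin] with ε hε
    have hε' : 0 < ε := hε
    have := integral_regularized_le hu hv hw huv hvw hq hε'
    simpa only [F, abs_of_pos hε'] using this
  have hp : Continuous fun x => ‖v x‖ ^ (2 * q) := hv.norm.rpow_const fun _ => Or.inr (by positivity)
  have hp2 : Continuous fun x => ‖v x‖ ^ (2 * q + 2) :=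
    hv.norm.rpow_const fun _ => Or.inr (by positivity)
  have h1 : ∀ x, F 0 x = ‖v x‖ ^ (2 * q + 2)
      - (2 * q + 1) * (‖u x‖ * ‖v x‖ ^ (2 * q) * ‖w x‖) := by
    intro x
    have e1 : (‖v x‖ ^ 2) ^ q = ‖v x‖ ^ (2 * q) := by
      rw [← Real.rpow_two, ← Real.rpow_mul (norm_nonneg _)]
    have e2 : ‖v x‖ ^ (2 * q + 2) = ‖v x‖ ^ (2 * q) * ‖v x‖ ^ 2 := by
      rw [Real.rpow_add_of_nonneg (norm_nonneg _) (by positivity) (by positivity), Real.rpow_two]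
    simp only [F, abs_zero, zero_add, e1, e2]
    ring
  simp only [h1] at h0
  rw [integral_sub (integrable_of_continuous hp2) (integrable_of_continuous (by fun_prop)),
    integral_const_mul] at h0
  linarith

/-- The function `r^{2s/a}`, with the convention that it is constantly `1` for `a = 0`. -/
def gnPow (s a : ℕ) (r : ℝ) : ℝ := if a = 0 then 1 else r ^ (2 * s / a : ℝ)

lemma gnPow_nonneg (s a : ℕ) {r : ℝ} (hr : 0 ≤ r) : 0 ≤ gnPow s a r := by
  unfold gnPow; split_ifs <;> positivity

lemma le_gnPow_rpow {s a : ℕ} (hs : 1 ≤ s) {r : ℝ} (hr : 0 ≤ r) (h0 : a = 0 → r ≤ 1) :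
    r ≤ gnPow s a r ^ (a / (2 * s) : ℝ) := by
  unfold gnPow
  have hs' : (s : ℝ) ≠ 0 := by positivity
  split_ifs with h
  · simpa using h0 h
  · have ha : (a : ℝ) ≠ 0 := by exact_mod_cast h
    rw [← Real.rpow_mul hr]
    have : (2 * s / a * (a / (2 * s)) : ℝ) = 1 := by field_simp
    rw [this, Real.rpow_one]

/-- Weighted AM–GM: the weights a/(2s), (s-a-1)/s and (a+2)/(2s) add up to 1. For a = 0 the first
factor has weight 0 and is controlled by x ≤ 1, the L^∞ endpoint. -/
lemma mul_rpow_mul_le {s a : ℕ} (has : a + 1 < s) {x y z : ℝ} (hx : 0 ≤ x)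
    (hy : 0 ≤ y) (hz : 0 ≤ z) (h0 : a = 0 → x ≤ 1) :
    x * y ^ (2 * (s / (a + 1 : ℕ) - 1) : ℝ) * z
      ≤ (a / (2 * s) : ℝ) * gnPow s a x + ((s - (a + 1 : ℕ)) / s : ℝ) * gnPow s (a + 1) y
        + ((a + 2 : ℕ) / (2 * s) : ℝ) * gnPow s (a + 2) z := by
  have hs : 1 ≤ s := by omega
  have hs0 : (0 : ℝ) < s := by positivity
  have hsa : ((a + 1 : ℕ) : ℝ) ≤ s := by exact_mod_cast has.le
  have h := Real.geom_mean_le_arith_mean3_weighted (w₁ := (a / (2 * s) : ℝ))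
    (w₂ := ((s - (a + 1 : ℕ)) / s : ℝ)) (w₃ := ((a + 2 : ℕ) / (2 * s) : ℝ))
    (by positivity) (div_nonneg (by linarith) hs0.le) (by positivity) (gnPow_nonneg s a hx)
    (gnPow_nonneg s (a + 1) hy) (gnPow_nonneg s (a + 2) hz) (by push_cast; field_simp; ring)
  refine le_trans ?_ h
  have hy' : y ^ (2 * (s / (a + 1 : ℕ) - 1) : ℝ)
      = gnPow s (a + 1) y ^ ((s - (a + 1 : ℕ)) / s : ℝ) := by
    rw [gnPow, if_neg (by omega), ← Real.rpow_mul hy]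
    congr 1
    push_cast
    field_simp
  rw [hy']
  refine mul_le_mul (mul_le_mul_of_nonneg_right (le_gnPow_rpow hs hx h0) ?_)
    (le_gnPow_rpow hs hz (by omega)) hz ?_
  · exact Real.rpow_nonneg (gnPow_nonneg _ _ hy) _
  · exact mul_nonneg (Real.rpow_nonneg (gnPow_nonneg _ _ hx) _)
      (Real.rpow_nonneg (gnPow_nonneg _ _ hy) _)

/-- The scaling factors turning the interpolation constants into constants below `1`. -/
def gnScale (s a : ℕ) : ℝ := ((2 * s : ℝ) ^ (a * (s - a)))⁻¹

lemma gnScale_pos {s : ℕ} (hs : 1 ≤ s) (a : ℕ) : 0 < gnScale s a := by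
  unfold gnScale; positivity

/-- The exponent a(s-a) has second difference -2, so each middle scale gains the factor (2s)^{-2}.
This beats the factor 2q+1 ≤ 2s from the integration by parts. -/
lemma gnScale_sq {s a : ℕ} (has : a + 1 < s) :
    gnScale s (a + 1) ^ 2 = ((2 * s : ℝ) ^ 2)⁻¹ * (gnScale s a * gnScale s (a + 2)) := by
  obtain ⟨b, rfl⟩ := Nat.exists_eq_add_of_lt has
  simp only [gnScale, ← mul_inv, inv_pow, ← pow_mul, ← pow_add]
  congr 2
  have e1 : a + 1 + b + 1 - (a + 1) = b + 1 := by omega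
  have e2 : a + 1 + b + 1 - a = b + 2 := by omega
  have e3 : a + 1 + b + 1 - (a + 2) = b := by omega
  rw [e1, e2, e3]
  ring

lemma continuous_gnPow_norm {W : Type*} [NormedAddCommGroup W] {u : Torus d → W} (hu : Continuous u) (s a : ℕ) (c : ℝ) :
    Continuous fun x => gnPow s a (c * ‖u x‖) := by
  unfold gnPow
  split_ifs
  · exact continuous_const
  · exact (continuous_const.mul hu.norm).rpow_const fun _ => Or.inr (by positivity)

/-- A maximum principle in the order of differentiation. If the scaled integral at order a+1
dominates both its neighbours, integration by parts and AM–GM bound it by a factor below 1 times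
itself, so it cannot be positive. -/
lemma integral_gnPow_step {s a : ℕ} (has : a + 1 < s) {u v w : Torus d → V}
    (hu : Continuous u) (hv : Continuous v) (hw : Continuous w) (huv : HasAxisDeriv i u v)
    (hvw : HasAxisDeriv i v w) (h0 : a = 0 → ∀ x, ‖u x‖ ≤ 1) {m : ℝ}
    (hum : ∫ x, gnPow s a (gnScale s a * ‖u x‖) ∂(torusMeasure d) ≤ m)
    (hwm : ∫ x, gnPow s (a + 2) (gnScale s (a + 2) * ‖w x‖) ∂(torusMeasure d) ≤ m)
    (hvm : ∫ x, gnPow s (a + 1) (gnScale s (a + 1) * ‖v x‖) ∂(torusMeasure d) = m) :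
    m ≤ 0 := by
  have hs : 1 ≤ s := by omega
  have hs0 : (0 : ℝ) < s := by positivity
  have ha1 : (1 : ℝ) ≤ ((a + 1 : ℕ) : ℝ) := by exact_mod_cast Nat.le_add_left 1 a
  have hsa : ((a + 1 : ℕ) : ℝ) < s := by exact_mod_cast has
  set q : ℝ := s / (a + 1 : ℕ) - 1 with hq
  have hq0 : 0 < q := by
    rw [hq, sub_pos, lt_div_iff₀ (by positivity)]; linarith
  have hqs : 2 * q + 1 ≤ 2 * s := by
    have : (s : ℝ) / (a + 1 : ℕ) ≤ s := div_le_self hs0.le ha1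
    rw [hq]; linarith
  set c0 := gnScale s a with hc0
  set c1 := gnScale s (a + 1) with hc1
  set c2 := gnScale s (a + 2) with hc2
  have p0 : 0 < c0 := gnScale_pos hs _
  have p1 : 0 < c1 := gnScale_pos hs _
  have p2 : 0 < c2 := gnScale_pos hs _
  have h1 := integral_norm_rpow_le hu hv hw huv hvw hq0
  have hpow : ∀ x, gnPow s (a + 1) (c1 * ‖v x‖) = c1 ^ (2 * q + 2) * ‖v x‖ ^ (2 * q + 2) := by
    intro x
    rw [gnPow, if_neg (by omega), ← Real.mul_rpow p1.le (norm_nonneg _)]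
    congr 1
    rw [hq]; push_cast; ring
  have hexp : c1 ^ (2 * q + 2) = c1 ^ (2 * q) * (((2 * s : ℝ) ^ 2)⁻¹ * (c0 * c2)) := by
    rw [← gnScale_sq has, Real.rpow_add p1, Real.rpow_two]
  have hpt : ∀ x, c1 ^ (2 * q + 2) * (‖u x‖ * ‖v x‖ ^ (2 * q) * ‖w x‖)
      ≤ ((2 * s : ℝ) ^ 2)⁻¹ * ((a / (2 * s) : ℝ) * gnPow s a (c0 * ‖u x‖)
        + ((s - (a + 1 : ℕ)) / s : ℝ) * gnPow s (a + 1) (c1 * ‖v x‖)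
        + ((a + 2 : ℕ) / (2 * s) : ℝ) * gnPow s (a + 2) (c2 * ‖w x‖)) := by
    intro x
    have h2 := mul_rpow_mul_le has (x := c0 * ‖u x‖) (y := c1 * ‖v x‖) (z := c2 * ‖w x‖)
      (by positivity) (by positivity) (by positivity) (by
        intro h
        have : c0 = 1 := by rw [hc0, gnScale, h]; simp
        rw [this, one_mul]; exact h0 h x)
    rw [hexp]
    calc _ = ((2 * s : ℝ) ^ 2)⁻¹ * (c0 * ‖u x‖ * (c1 * ‖v x‖) ^ (2 * q) * (c2 * ‖w x‖)) := by
          rw [Real.mul_rpow p1.le (norm_nonneg _)]; ring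
      _ ≤ _ := mul_le_mul_of_nonneg_left h2 (by positivity)
  have hcu := continuous_gnPow_norm hu s a c0
  have hcv := continuous_gnPow_norm hv s (a + 1) c1
  have hcw := continuous_gnPow_norm hw s (a + 2) c2
  have hp : Continuous fun x => ‖v x‖ ^ (2 * q) :=
    hv.norm.rpow_const fun _ => Or.inr (by positivity)
  have h3 := integral_mono (μ := torusMeasure d)
    (integrable_of_continuous (by fun_prop)) (integrable_of_continuous (by fun_prop)) hpt
  rw [integral_const_mul, integral_const_mul, integral_add
    (integrable_of_continuous (by fun_prop)) (integrable_of_continuous (by fun_prop)), integral_add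
    (integrable_of_continuous (by fun_prop)) (integrable_of_continuous (by fun_prop)),
    integral_const_mul, integral_const_mul, integral_const_mul, hvm] at h3
  simp only [hpow, integral_const_mul] at hvm
  have h4 : m ≤ (2 * q + 1) * (((2 * s : ℝ) ^ 2)⁻¹ * m) := by
    calc m = c1 ^ (2 * q + 2) * ∫ x, ‖v x‖ ^ (2 * q + 2) ∂(torusMeasure d) := hvm.symm
      _ ≤ c1 ^ (2 * q + 2) * ((2 * q + 1)
            * ∫ x, ‖u x‖ * ‖v x‖ ^ (2 * q) * ‖w x‖ ∂(torusMeasure d)) := by gcongr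
      _ = (2 * q + 1) * (c1 ^ (2 * q + 2)
            * ∫ x, ‖u x‖ * ‖v x‖ ^ (2 * q) * ‖w x‖ ∂(torusMeasure d)) := by ring
      _ ≤ _ := by
        refine mul_le_mul_of_nonneg_left (h3.trans ?_) (by positivity)
        refine mul_le_mul_of_nonneg_left ?_ (by positivity)
        have g1 : (a / (2 * s) : ℝ) * ∫ x, gnPow s a (c0 * ‖u x‖) ∂(torusMeasure d)
          ≤ (a / (2 * s) : ℝ) * m := mul_le_mul_of_nonneg_left hum (by positivity)
        have g2 : ((a + 2 : ℕ) / (2 * s) : ℝ)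
            * ∫ x, gnPow s (a + 2) (c2 * ‖w x‖) ∂(torusMeasure d)
          ≤ ((a + 2 : ℕ) / (2 * s) : ℝ) * m := mul_le_mul_of_nonneg_left hwm (by positivity)
        have g3 : (a / (2 * s) : ℝ) * m + ((s - (a + 1 : ℕ)) / s : ℝ) * m
            + ((a + 2 : ℕ) / (2 * s) : ℝ) * m = m := by push_cast; field_simp; ring
        linarith
  by_contra! hm
  have h5 : (2 * q + 1) * ((2 * s : ℝ) ^ 2)⁻¹ < 1 := by
    rw [← div_eq_mul_inv, div_lt_one (by positivity)]
    have : (1 : ℝ) ≤ s := by exact_mod_cast hs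
    nlinarith
  nlinarith

/-- The interpolation constants. -/
def gnConst (s a : ℕ) : ℝ := ((2 * s : ℝ) ^ (a * (s - a))) ^ (2 * s / a : ℝ)

lemma gnConst_nonneg (s a : ℕ) : 0 ≤ gnConst s a := by unfold gnConst; positivity

/-- **Gagliardo–Nirenberg inequality** in a coordinate direction of the torus: if `u₀` is bounded
by `1` and its `s`-th derivative is bounded by `1` in `L²`, then the `a`-th derivative is bounded
in `L^{2s/a}`. -/
theorem gagliardoNirenberg {s : ℕ} {u : ℕ → Torus d → V} (hc : ∀ a, Continuous (u a))
    (hd : ∀ a, HasAxisDeriv i (u a) (u (a + 1))) (h0 : ∀ x, ‖u 0 x‖ ≤ 1)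
    (hsu : ∫ x, ‖u s x‖ ^ 2 ∂(torusMeasure d) ≤ 1) {a : ℕ} (ha : 1 ≤ a) (has : a ≤ s) :
    ∫ x, ‖u a x‖ ^ (2 * s / a : ℝ) ∂(torusMeasure d) ≤ gnConst s a := by
  have hs : 1 ≤ s := ha.trans has
  let J : ℕ → ℝ := fun a => ∫ x, gnPow s a (gnScale s a * ‖u a x‖) ∂(torusMeasure d)
  have key : ∀ a ∈ Finset.range (s + 1), J a ≤ 1 := by
    -- At an endpoint the maximum of `J` is at most 1: J 0 = 1 by the convention in `gnPow`, and J s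
    -- ≤ 1 by hypothesis. At an interior order it is at most 0.
    obtain ⟨b, hb, hmax⟩ := Finset.exists_max_image (Finset.range (s + 1)) J ⟨0, by simp⟩
    suffices J b ≤ 1 from fun a ha => (hmax a ha).trans this
    rw [Finset.mem_range] at hb
    rcases Nat.eq_zero_or_pos b with rfl | hb0
    · simp [J, gnPow]
    rcases eq_or_lt_of_le (Nat.lt_succ_iff.1 hb) with rfl | hbs
    · have hb' : (b : ℝ) ≠ 0 := by positivity
      have : (2 * b / b : ℝ) = 2 := by field_simp
      simpa [J, gnPow, hb0.ne', gnScale, this] using hsu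
    obtain ⟨c, rfl⟩ : ∃ c, b = c + 1 := ⟨b - 1, by omega⟩
    have := integral_gnPow_step (i := i) (m := J (c + 1)) hbs (hc c) (hc (c + 1)) (hc (c + 2))
      (hd c) (hd (c + 1)) (by rintro rfl; exact h0) (hmax c (by simp; omega))
      (hmax (c + 2) (by simp; omega)) rfl
    linarith
  have h1 := key a (by simp; omega)
  have hp : 0 < (2 * s : ℝ) ^ (a * (s - a)) := by positivity
  have h2 : J a = (gnConst s a)⁻¹ * ∫ x, ‖u a x‖ ^ (2 * s / a : ℝ) ∂(torusMeasure d) := by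
    rw [← integral_const_mul]
    refine integral_congr_ae (Filter.Eventually.of_forall fun x => ?_)
    simp only [gnPow]
    rw [if_neg (by omega), Real.mul_rpow (gnScale_pos hs a).le (norm_nonneg _), gnScale,
      Real.inv_rpow hp.le, gnConst]
  have h3 : 0 < gnConst s a := by unfold gnConst; positivity
  rwa [h2, inv_mul_le_iff₀ h3, mul_one] at h1

end GagliardoNirenberg

/-! # Real and imaginary parts of vectors -/

/-- `toComplex` as a continuous linear map. -/
def toComplexL (m : ℕ) : RVec m →L[ℝ] CVec m :=
  LinearMap.toContinuousLinearMap
    { toFun := toComplex, map_add' := toComplex_add, map_smul' := toComplex_smul }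

/-- `rePart` as a continuous linear map. -/
def rePartL (m : ℕ) : CVec m →L[ℝ] RVec m :=
  LinearMap.toContinuousLinearMap
    { toFun := rePart
      map_add' := fun v w => by ext i; simp [rePart]
      map_smul' := fun c v => by ext i; simp [rePart] }

lemma toComplexL_apply {m : ℕ} (v : RVec m) : toComplexL m v = toComplex v := rfl

lemma rePartL_apply {m : ℕ} (v : CVec m) : rePartL m v = rePart v := rfl

lemma continuous_rePart {m : ℕ} : Continuous (rePart (m := m)) := (rePartL m).continuous

lemma rePart_toComplex {m : ℕ} (v : RVec m) : rePart (toComplex v) = v := by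
  ext i; simp [rePart, toComplex]

lemma norm_toComplex {m : ℕ} (v : RVec m) : ‖toComplex v‖ = ‖v‖ := by
  simp [EuclideanSpace.norm_eq, toComplex]

lemma norm_rePart_le {m : ℕ} (z : CVec m) : ‖rePart z‖ ≤ ‖z‖ := by
  simp only [EuclideanSpace.norm_eq, rePart]
  gcongr with i
  exact Complex.abs_re_le_norm _

/-! # Iterated directional derivatives -/

section Chains

variable {d : ℕ} {E F : Type*} [NormedAddCommGroup E] [NormedSpace ℝ E]
  [NormedAddCommGroup F] [NormedSpace ℝ F] {i : Fin d}

lemma HasAxisDeriv.clm_comp {g g' : Torus d → E} (h : HasAxisDeriv i g g') (L : E →L[ℝ] F) :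
    HasAxisDeriv i (fun x => L (g x)) (fun x => L (g' x)) :=
  fun x => L.hasFDerivAt.comp_hasDerivAt 0 (h x)

lemma iteratedDeriv_line {h : ℕ → Torus d → E} (hd : ∀ a, HasAxisDeriv i (h a) (h (a + 1)))
    (x : Torus d) (a : ℕ) :
    iteratedDeriv a (fun t => h 0 (x + axisShift i t)) = fun t => h a (x + axisShift i t) := by
  induction a with
  | zero => simp
  | succ a ih =>
    rw [iteratedDeriv_succ, ih]
    exact funext fun t => ((hd a).hasDerivAt x t).deriv

lemma contDiff_line {h : ℕ → Torus d → E} (hd : ∀ a, HasAxisDeriv i (h a) (h (a + 1)))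
    (x : Torus d) : ContDiff ℝ ∞ (fun t => h 0 (x + axisShift i t)) := by
  refine contDiff_of_differentiable_iteratedDeriv fun a _ => ?_
  rw [iteratedDeriv_line hd]
  exact fun t => ((hd a).hasDerivAt x t).differentiableAt

lemma mFourierCoeff_chain {G : Type*} [NormedAddCommGroup G] [NormedSpace ℂ G] [CompleteSpace G]
    {h : ℕ → Torus d → G} (hc : ∀ a, Continuous (h a))
    (hd : ∀ a, HasAxisDeriv i (h a) (h (a + 1))) (k : Fin d → ℤ) (a : ℕ) :
    mFourierCoeff (h a) k = (2 * Real.pi * Complex.I * k i : ℂ) ^ a • mFourierCoeff (h 0) k := by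
  induction a with
  | zero => simp
  | succ a ih => rw [mFourierCoeff_axisDeriv (hc a) (hc _) (hd a), ih, smul_smul, pow_succ']

end Chains

/-! # Composition estimate -/

section Composition

variable {d m n : ℕ} {i : Fin d}

/-- Pointwise Faà di Bruno bound along a coordinate direction. -/
lemma norm_chain_comp_le {s : ℕ} (hs : 1 ≤ s) {σ : RVec m → RVec n} (hσ : ContDiff ℝ ∞ σ) {B : ℝ}
    (hB : 0 ≤ B) (hσB : ∀ j : ℕ, 1 ≤ j → j ≤ s → ∀ y, ‖iteratedFDeriv ℝ j σ y‖ ≤ B) (b : RVec m)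
    {u : ℕ → Torus d → RVec m} (hu : ∀ a, HasAxisDeriv i (u a) (u (a + 1)))
    {h : ℕ → Torus d → RVec n} (hh : ∀ a, HasAxisDeriv i (h a) (h (a + 1)))
    (h0 : ∀ x, h 0 x = σ (b + u 0 x)) (x : Torus d) {D : ℝ}
    (hD : ∀ a, 1 ≤ a → a ≤ s → ‖u a x‖ ≤ D ^ a) : ‖h s x‖ ≤ s.factorial * B * D ^ s := by
  -- The composition bound in Mathlib also asks for a bound at order 0, which σ need not satisfy.
  -- Subtracting the value at the base point makes the order-0 term vanish and changes no
  -- derivative; `h'` is the matching change in the chain.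
  set τ : RVec m → RVec n := fun y => σ (b + y) - σ (b + u 0 x) with hτ
  have hτs : ContDiff ℝ ∞ τ := (hσ.comp (contDiff_const.add contDiff_id)).sub contDiff_const
  have hτB : ∀ j, j ≤ s → ‖iteratedFDeriv ℝ j τ (u 0 (x + axisShift i 0))‖ ≤ B := by
    intro j hj
    rcases Nat.eq_zero_or_pos j with rfl | hj0
    · simpa [hτ, axisShift_zero] using hB
    · have e1 : τ = (fun y => σ (b + y)) + fun _ => -σ (b + u 0 x) := by
        funext y; simp [hτ, sub_eq_add_neg]
      rw [e1, iteratedFDeriv_add_apply, iteratedFDeriv_const_of_ne hj0.ne', Pi.zero_apply,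
        add_zero, iteratedFDeriv_comp_add_left]
      · exact hσB j hj0 hj _
      · exact ((hσ.comp (contDiff_const.add contDiff_id)).contDiffAt).of_le (by exact_mod_cast le_top)
      · exact contDiffAt_const
  have hl := contDiff_line hu x
  have key := norm_iteratedFDeriv_comp_le (n := s) hτs hl (by exact_mod_cast le_top) (0 : ℝ) hτB
    (D := D) (fun j hj1 hj2 => by
      rw [norm_iteratedFDeriv_eq_norm_iteratedDeriv, iteratedDeriv_line hu]
      simpa [axisShift_zero] using hD j hj1 hj2)
  rw [norm_iteratedFDeriv_eq_norm_iteratedDeriv] at key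
  let h' : ℕ → Torus d → RVec n := fun a y => if a = 0 then h 0 y - σ (b + u 0 x) else h a y
  have hh' : ∀ a, HasAxisDeriv i (h' a) (h' (a + 1)) := by
    intro a
    rcases Nat.eq_zero_or_pos a with rfl | ha
    · intro y
      simpa [h'] using (hh 0 y).sub_const (σ (b + u 0 x))
    · intro y
      simpa [h', ha.ne'] using hh a y
  have e2 : τ ∘ (fun t => u 0 (x + axisShift i t)) = fun t => h' 0 (x + axisShift i t) := by
    funext t
    simp [hτ, h', h0]
  rw [e2, iteratedDeriv_line hh'] at key
  have hs0 : s ≠ 0 := by omega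
  simpa [h', hs0, axisShift_zero] using key

/-- With Q the sum on the right, take D = Q^{1/(2s)}: every |u_a|^{2s/a} is at most Q, hence |u_a| ≤
D^a, and (D^s)² = Q. -/
lemma norm_sq_chain_comp_le {s : ℕ} (hs : 1 ≤ s) {σ : RVec m → RVec n} (hσ : ContDiff ℝ ∞ σ)
    {B : ℝ} (hB : 0 ≤ B)
    (hσB : ∀ j : ℕ, 1 ≤ j → j ≤ s → ∀ y, ‖iteratedFDeriv ℝ j σ y‖ ≤ B) (b : RVec m)
    {u : ℕ → Torus d → RVec m} (hu : ∀ a, HasAxisDeriv i (u a) (u (a + 1)))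
    {h : ℕ → Torus d → RVec n} (hh : ∀ a, HasAxisDeriv i (h a) (h (a + 1)))
    (h0 : ∀ x, h 0 x = σ (b + u 0 x)) (x : Torus d) :
    ‖h s x‖ ^ 2 ≤ (s.factorial * B) ^ 2 * ∑ a ∈ Finset.Icc 1 s, ‖u a x‖ ^ (2 * s / a : ℝ) := by
  set Q := ∑ a ∈ Finset.Icc 1 s, ‖u a x‖ ^ (2 * s / a : ℝ) with hQ
  have hQ0 : 0 ≤ Q := Finset.sum_nonneg fun a _ => by positivity
  have hs0 : (0 : ℝ) < s := by positivity
  have h1 := norm_chain_comp_le hs hσ hB hσB b hu hh h0 x (D := Q ^ (1 / (2 * s) : ℝ)) (by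
    intro a ha has
    have ha0 : (0 : ℝ) < a := by positivity
    have e1 : ‖u a x‖ = (‖u a x‖ ^ (2 * s / a : ℝ)) ^ (a / (2 * s) : ℝ) := by
      rw [← Real.rpow_mul (norm_nonneg _)]
      have : (2 * s / a * (a / (2 * s)) : ℝ) = 1 := by field_simp
      rw [this, Real.rpow_one]
    have e2 : (Q ^ (1 / (2 * s) : ℝ)) ^ a = Q ^ (a / (2 * s) : ℝ) := by
      rw [← Real.rpow_natCast, ← Real.rpow_mul hQ0]
      congr 1; field_simp
    rw [e1, e2]
    refine Real.rpow_le_rpow (by positivity) ?_ (by positivity)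
    exact Finset.single_le_sum (f := fun a : ℕ => ‖u a x‖ ^ (2 * s / a : ℝ))
      (fun a _ => by positivity) (Finset.mem_Icc.2 ⟨ha, has⟩))
  have e3 : ((Q ^ (1 / (2 * s) : ℝ)) ^ s) ^ 2 = Q := by
    rw [← pow_mul, ← Real.rpow_natCast, ← Real.rpow_mul hQ0]
    have : (1 / (2 * s) * ((s * 2 : ℕ) : ℝ) : ℝ) = 1 := by push_cast; field_simp
    rw [this, Real.rpow_one]
  calc ‖h s x‖ ^ 2 ≤ (s.factorial * B * (Q ^ (1 / (2 * s) : ℝ)) ^ s) ^ 2 := by gcongr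
    _ = _ := by rw [mul_pow, e3]

/-- The constant in the bound for the top derivative of a composition. -/
def compConst (s : ℕ) (B R : ℝ) : ℝ :=
  (s.factorial * B) ^ 2 * (R ^ (2 * s) * ∑ a ∈ Finset.Icc 1 s, gnConst s a)

lemma integral_chain_comp_le {s : ℕ} (hs : 1 ≤ s) {σ : RVec m → RVec n} (hσ : ContDiff ℝ ∞ σ)
    {B : ℝ} (hB : 0 ≤ B)
    (hσB : ∀ j : ℕ, 1 ≤ j → j ≤ s → ∀ y, ‖iteratedFDeriv ℝ j σ y‖ ≤ B) (b : RVec m)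
    {u : ℕ → Torus d → RVec m} (huc : ∀ a, Continuous (u a))
    (hu : ∀ a, HasAxisDeriv i (u a) (u (a + 1)))
    {h : ℕ → Torus d → RVec n} (hhc : ∀ a, Continuous (h a))
    (hh : ∀ a, HasAxisDeriv i (h a) (h (a + 1)))
    (h0 : ∀ x, h 0 x = σ (b + u 0 x)) {R : ℝ} (hR : 1 ≤ R) (hu0 : ∀ x, ‖u 0 x‖ ≤ R)
    (hus : ∫ x, ‖u s x‖ ^ 2 ∂(torusMeasure d) ≤ R ^ 2) :
    ∫ x, ‖h s x‖ ^ 2 ∂(torusMeasure d) ≤ compConst s B R := by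
  have hR0 : 0 < R := by linarith
  have hpc : ∀ a : ℕ, Continuous fun x => ‖u a x‖ ^ (2 * s / a : ℝ) := fun a =>
    (huc a).norm.rpow_const fun _ => Or.inr (by positivity)
  have hgn : ∀ a ∈ Finset.Icc 1 s,
      ∫ x, ‖u a x‖ ^ (2 * s / a : ℝ) ∂(torusMeasure d) ≤ R ^ (2 * s) * gnConst s a := by
    intro a ha
    obtain ⟨ha1, has⟩ := Finset.mem_Icc.1 ha
    have ha0 : (0 : ℝ) < a := by positivity
    -- Dividing by `R` normalizes both endpoint bounds to 1. Undoing it costs R^{2s/a}, which is at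
    -- most R^{2s} because R ≥ 1.
    have h1 := gagliardoNirenberg (i := i) (s := s) (u := fun a x => R⁻¹ • u a x)
      (fun a => by have := huc a; fun_prop)
      (fun a => (hu a).clm_comp (R⁻¹ • ContinuousLinearMap.id ℝ (RVec m)))
      (fun x => by
        rw [norm_smul, norm_inv, Real.norm_of_nonneg hR0.le, inv_mul_le_iff₀ hR0, mul_one]
        exact hu0 x)
      (by
        simp only [norm_smul, norm_inv, Real.norm_of_nonneg hR0.le, mul_pow, integral_const_mul]
        rw [inv_pow, inv_mul_le_iff₀ (by positivity), mul_one]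
        exact hus) ha1 has
    simp only [norm_smul, norm_inv, Real.norm_of_nonneg hR0.le,
      Real.mul_rpow (inv_nonneg.2 hR0.le) (norm_nonneg _), integral_const_mul,
      Real.inv_rpow hR0.le] at h1
    rw [inv_mul_le_iff₀ (by positivity)] at h1
    refine h1.trans (mul_le_mul_of_nonneg_right ?_ (gnConst_nonneg _ _))
    rw [← Real.rpow_natCast]
    refine Real.rpow_le_rpow_of_exponent_le hR ?_
    push_cast
    exact div_le_self (by positivity) (by exact_mod_cast ha1)
  have hsum : Continuous fun x => ∑ a ∈ Finset.Icc 1 s, ‖u a x‖ ^ (2 * s / a : ℝ) :=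
    continuous_finsetSum _ fun a _ => hpc a
  calc ∫ x, ‖h s x‖ ^ 2 ∂(torusMeasure d)
      ≤ ∫ x, (s.factorial * B) ^ 2 * ∑ a ∈ Finset.Icc 1 s, ‖u a x‖ ^ (2 * s / a : ℝ)
          ∂(torusMeasure d) :=
        integral_mono (integrable_of_continuous ((hhc s).norm.pow 2))
          (integrable_of_continuous (continuous_const.mul hsum))
          (norm_sq_chain_comp_le hs hσ hB hσB b hu hh h0)
    _ = (s.factorial * B) ^ 2 * ∑ a ∈ Finset.Icc 1 s,
          ∫ x, ‖u a x‖ ^ (2 * s / a : ℝ) ∂(torusMeasure d) := by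
        rw [integral_const_mul, integral_finsetSum _ fun a _ => integrable_of_continuous (hpc a)]
    _ ≤ _ := by
        refine mul_le_mul_of_nonneg_left ?_ (by positivity)
        rw [Finset.mul_sum]
        exact Finset.sum_le_sum hgn

end Composition

/-! # Real trigonometric polynomials -/

section TrigPoly

variable {d m n : ℕ}

lemma hasAxisDeriv_mFourier (i : Fin d) (k : Fin d → ℤ) :
    HasAxisDeriv i (mFourier k) (fun x => 2 * Real.pi * Complex.I * k i * mFourier k x) := by
  intro x
  simp only [mFourier_add_axisShift]
  refine HasDerivAt.mul_const ?_ _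
  have h2 : HasDerivAt (fun t : ℝ => (2 * Real.pi * Complex.I * k i * (t : ℂ)))
      (2 * Real.pi * Complex.I * k i * 1) 0 :=
    (Complex.ofRealCLM.hasDerivAt (x := (0 : ℝ))).const_mul _
  simpa using h2.cexp

/-- The vector of the Fourier monomials with frequencies in `S`. -/
def monomials (S : Finset (Fin d → ℤ)) (x : Torus d) : S → ℂ := fun k => mFourier k.1 x

lemma continuous_monomials (S : Finset (Fin d → ℤ)) : Continuous (monomials S) :=
  continuous_pi fun k => (mFourier k.1).continuous

/-- The generator of the translations in direction `i`, acting on the vector of monomials. -/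
def monomialsGen (S : Finset (Fin d → ℤ)) (i : Fin d) : (S → ℂ) →L[ℝ] (S → ℂ) :=
  ContinuousLinearMap.pi fun k =>
    (ContinuousLinearMap.mul ℝ ℂ (2 * Real.pi * Complex.I * k.1 i)).comp
      (ContinuousLinearMap.proj k)

lemma hasAxisDeriv_monomials (S : Finset (Fin d → ℤ)) (i : Fin d) :
    HasAxisDeriv i (monomials S) (fun x => monomialsGen S i (monomials S x)) := by
  intro x
  refine hasDerivAt_pi.2 fun k => ?_
  exact hasAxisDeriv_mFourier i k.1 x

/-- The iterated derivatives of `H ∘ monomials S` in direction `i`, as functions of the vector of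
monomials. -/
def monomialsDeriv {V : Type*} [NormedAddCommGroup V] [NormedSpace ℝ V] (S : Finset (Fin d → ℤ))
    (i : Fin d) (H : (S → ℂ) → V) : ℕ → (S → ℂ) → V
  | 0 => H
  | a + 1 => fun z => fderiv ℝ (monomialsDeriv S i H a) z (monomialsGen S i z)

lemma contDiff_monomialsDeriv {V : Type*} [NormedAddCommGroup V] [NormedSpace ℝ V]
    (S : Finset (Fin d → ℤ)) (i : Fin d) {H : (S → ℂ) → V} (hH : ContDiff ℝ ∞ H) (a : ℕ) :
    ContDiff ℝ ∞ (monomialsDeriv S i H a) := by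
  induction a with
  | zero => exact hH
  | succ a ih =>
    exact (ih.fderiv_right (m := ∞) (by simp)).clm_apply (monomialsGen S i).contDiff

/-- Translations act linearly on the vector of monomials, so differentiating along the torus is
differentiating `H` along a linear vector field on a finite-dimensional space. This gives all axis
derivatives of σ composed with a trigonometric polynomial without a smooth structure on the torus.
-/
lemma hasAxisDeriv_monomialsDeriv {V : Type*} [NormedAddCommGroup V] [NormedSpace ℝ V]
    (S : Finset (Fin d → ℤ)) (i : Fin d) {H : (S → ℂ) → V} (hH : ContDiff ℝ ∞ H) (a : ℕ) :
    HasAxisDeriv i (fun x => monomialsDeriv S i H a (monomials S x))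
      (fun x => monomialsDeriv S i H (a + 1) (monomials S x)) := by
  intro x
  have h1 := ((contDiff_monomialsDeriv S i hH a).differentiable (by simp)
    (monomials S (x + axisShift i 0))).hasFDerivAt
  have h2 := h1.comp_hasDerivAt (0 : ℝ) (hasAxisDeriv_monomials S i x)
  simpa [axisShift_zero, monomialsDeriv] using! h2

/-- The trigonometric polynomial with coefficients `c`, as a function of the vector of
monomials. -/
def monomialsComb (S : Finset (Fin d → ℤ)) (c : (Fin d → ℤ) → CVec m) : (S → ℂ) →L[ℝ] RVec m :=
  (rePartL m).comp (∑ k : S, (ContinuousLinearMap.proj (R := ℝ) (φ := fun _ : S => ℂ) k).smulRight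
    (c k.1))

lemma monomialsComb_monomials (S : Finset (Fin d → ℤ)) (c : (Fin d → ℤ) → CVec m) (x : Torus d) :
    monomialsComb S c (monomials S x) = rePart (∑ k ∈ S, mFourier k x • c k) := by
  rw [← Finset.sum_coe_sort S]
  simp only [monomialsComb, ContinuousLinearMap.comp_apply, rePartL_apply]
  congr 1
  simp [monomials]

lemma mFourierCoeff_trigPoly (S : Finset (Fin d → ℤ)) (c : (Fin d → ℤ) → CVec m)
    (k : Fin d → ℤ) :
    mFourierCoeff (fun x => ∑ j ∈ S, mFourier j x • c j) k = if k ∈ S then c k else 0 := by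
  rw [mFourierCoeff_sum_fun S fun j => continuous_mFourier_smul continuous_const j]
  simp [mFourierCoeff_mFourier_smul]

lemma continuous_trigPoly (S : Finset (Fin d → ℤ)) (c : (Fin d → ℤ) → CVec m) :
    Continuous fun x => ∑ j ∈ S, mFourier j x • c j :=
  continuous_finsetSum _ fun j _ => continuous_mFourier_smul continuous_const j

lemma integral_norm_sq_trigPoly (S : Finset (Fin d → ℤ)) (c : (Fin d → ℤ) → CVec m) :
    ∫ x, ‖∑ j ∈ S, mFourier j x • c j‖ ^ 2 ∂(torusMeasure d) = ∑ j ∈ S, ‖c j‖ ^ 2 := by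
  refine (parseval (continuous_trigPoly S c)).unique ?_
  simp only [mFourierCoeff_trigPoly]
  rw [show ∑ j ∈ S, ‖c j‖ ^ 2 = ∑ k ∈ S, ‖if k ∈ S then c k else 0‖ ^ 2 from
    Finset.sum_congr rfl fun k hk => by rw [if_pos hk]]
  exact hasSum_sum_of_ne_finset_zero fun k hk => by simp [hk]

/-- Compare with the largest coordinate. The weight |k|^{2s} is thus controlled by pure coordinate
derivatives, and mixed derivatives are never needed. -/
lemma sum_sq_pow_le (k : Fin d → ℤ) {s : ℕ} (hs : 1 ≤ s) :
    (∑ i, (k i : ℝ) ^ 2) ^ s ≤ d ^ s * ∑ i, ((k i : ℝ) ^ 2) ^ s := by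
  rcases Nat.eq_zero_or_pos d with rfl | hd
  · simp [show s ≠ 0 by omega]
  obtain ⟨j, -, hj⟩ := Finset.exists_max_image Finset.univ (fun i => (k i : ℝ) ^ 2)
    ⟨⟨0, hd⟩, Finset.mem_univ _⟩
  have h1 : ∑ i, (k i : ℝ) ^ 2 ≤ d * (k j : ℝ) ^ 2 := by
    simpa using Finset.sum_le_card_nsmul Finset.univ (fun i => (k i : ℝ) ^ 2) _ hj
  calc (∑ i, (k i : ℝ) ^ 2) ^ s ≤ (d * (k j : ℝ) ^ 2) ^ s := by gcongr
    _ = d ^ s * ((k j : ℝ) ^ 2) ^ s := mul_pow _ _ _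
    _ ≤ _ := by
      gcongr
      exact Finset.single_le_sum (f := fun i => ((k i : ℝ) ^ 2) ^ s) (fun _ _ => by positivity)
        (Finset.mem_univ j)

lemma sq_pow_le_sum_sq_pow (k : Fin d → ℤ) (i : Fin d) (s : ℕ) :
    ((k i : ℝ) ^ 2) ^ s ≤ (∑ i, (k i : ℝ) ^ 2) ^ s := by
  gcongr
  exact Finset.single_le_sum (f := fun i => (k i : ℝ) ^ 2) (fun _ _ => sq_nonneg _)
    (Finset.mem_univ i)

lemma norm_freq_pow_sq (k : Fin d → ℤ) (i : Fin d) (s : ℕ) :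
    ‖(2 * Real.pi * Complex.I * k i : ℂ) ^ s‖ ^ 2
      = (2 * Real.pi) ^ (2 * s) * ((k i : ℝ) ^ 2) ^ s := by
  have : ‖(2 * Real.pi * Complex.I * k i : ℂ)‖ = 2 * Real.pi * |(k i : ℝ)| := by
    simp [abs_of_pos Real.pi_pos]
  rw [norm_pow, this, ← pow_mul, mul_pow, mul_comm s 2, pow_mul |_|, sq_abs]

/-- Composition with `σ` maps a trigonometric polynomial to a function with controlled Sobolev
seminorm. -/
lemma sum_sobolev_comp_trigPoly_le {s : ℕ} (hs : 1 ≤ s) {σ : RVec m → RVec n}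
    (hσ : ContDiff ℝ ∞ σ) {B : ℝ} (hB : 0 ≤ B)
    (hσB : ∀ j : ℕ, 1 ≤ j → j ≤ s → ∀ y, ‖iteratedFDeriv ℝ j σ y‖ ≤ B) (b : RVec m)
    (S : Finset (Fin d → ℤ)) (c : (Fin d → ℤ) → CVec m) {R : ℝ} (hR : 1 ≤ R)
    (h1 : ∑ k ∈ S, ‖c k‖ ≤ R)
    (h2 : (2 * Real.pi) ^ (2 * s) * ∑ k ∈ S, (∑ i, (k i : ℝ) ^ 2) ^ s * ‖c k‖ ^ 2 ≤ R ^ 2)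
    (F : Finset (Fin d → ℤ)) :
    ∑ k ∈ F, (∑ i, (k i : ℝ) ^ 2) ^ s
        * ‖fourierCoeffVec (fun x => σ (b + rePart (∑ k ∈ S, mFourier k x • c k))) k‖ ^ 2
      ≤ d ^ s * (d * compConst s B R) := by
  set g : Torus d → RVec n := fun x => σ (b + rePart (∑ k ∈ S, mFourier k x • c k)) with hg
  have key : ∀ i, ∑ k ∈ F, ((k i : ℝ) ^ 2) ^ s * ‖fourierCoeffVec g k‖ ^ 2
      ≤ compConst s B R := by
    intro i
    let ca : ℕ → (Fin d → ℤ) → CVec m := fun a k =>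
      (2 * Real.pi * Complex.I * k i : ℂ) ^ a • c k
    let u : ℕ → Torus d → RVec m := fun a x => monomialsComb S (ca a) (monomials S x)
    have huc : ∀ a, Continuous (u a) := fun a =>
      (monomialsComb S (ca a)).continuous.comp (continuous_monomials S)
    have hu : ∀ a, HasAxisDeriv i (u a) (u (a + 1)) := by
      intro a
      have e : u (a + 1) = fun x => monomialsComb S (ca a) (monomialsGen S i (monomials S x)) := by
        funext x
        simp only [u, monomialsComb, ContinuousLinearMap.comp_apply]
        congr 1
        simp only [sum_apply, ContinuousLinearMap.smulRight_apply,
          ContinuousLinearMap.proj_apply]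
        refine Finset.sum_congr rfl fun k _ => ?_
        simp only [ca, monomialsGen, ContinuousLinearMap.coe_pi', ContinuousLinearMap.comp_apply,
          ContinuousLinearMap.mul_apply', ContinuousLinearMap.proj_apply, smul_smul, pow_succ]
        congr 1; ring
      rw [e]
      exact (hasAxisDeriv_monomials S i).clm_comp (monomialsComb S (ca a))
    let H : (S → ℂ) → RVec n := fun z => σ (b + monomialsComb S c z)
    have hH : ContDiff ℝ ∞ H :=
      hσ.comp (contDiff_const.add (monomialsComb S c).contDiff)
    let h : ℕ → Torus d → RVec n := fun a x => monomialsDeriv S i H a (monomials S x)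
    have hhc : ∀ a, Continuous (h a) := fun a =>
      (contDiff_monomialsDeriv S i hH a).continuous.comp (continuous_monomials S)
    have hh : ∀ a, HasAxisDeriv i (h a) (h (a + 1)) := hasAxisDeriv_monomialsDeriv S i hH
    have hca0 : ca 0 = c := by funext k; simp [ca]
    have hh0 : ∀ x, h 0 x = σ (b + u 0 x) := by
      intro x; simp only [h, u, hca0, monomialsDeriv, H]
    have hg0 : h 0 = g := by
      funext x
      rw [hh0]
      simp only [u, hca0, hg, monomialsComb_monomials]
    have hint := integral_chain_comp_le hs hσ hB hσB b huc hu hhc hh hh0 hR (by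
      intro x
      simp only [u, hca0, monomialsComb_monomials]
      refine (norm_rePart_le _).trans ((norm_sum_le _ _).trans ?_)
      simpa [norm_smul, norm_mFourier_apply] using h1) (by
      refine le_trans ?_ h2
      calc ∫ x, ‖u s x‖ ^ 2 ∂(torusMeasure d)
          ≤ ∫ x, ‖∑ j ∈ S, mFourier j x • ca s j‖ ^ 2 ∂(torusMeasure d) := by
            refine integral_mono (integrable_of_continuous ((huc s).norm.pow 2))
              (integrable_of_continuous ((continuous_trigPoly S (ca s)).norm.pow 2)) fun x => ?_
            simp only [u, monomialsComb_monomials]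
            gcongr
            exact norm_rePart_le _
        _ = ∑ j ∈ S, ‖ca s j‖ ^ 2 := integral_norm_sq_trigPoly S _
        _ ≤ _ := by
            rw [Finset.mul_sum]
            refine Finset.sum_le_sum fun k _ => ?_
            simp only [ca, norm_smul, mul_pow _ ‖c k‖, norm_freq_pow_sq]
            rw [mul_assoc]
            exact mul_le_mul_of_nonneg_left (mul_le_mul_of_nonneg_right
              (sq_pow_le_sum_sq_pow k i s) (by positivity)) (by positivity))
    have hC : ∀ a, Continuous fun x => toComplexL n (h a x) := fun a =>
      (toComplexL n).continuous.comp (hhc a)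
    have hP := parseval (hC s)
    have hco := mFourierCoeff_chain hC (fun a => (hh a).clm_comp (toComplexL n))
    -- The coefficients of the `s`-th derivative carry the factor (2πi kᵢ)^s; the constant (2π)^{2s}
    -- ≥ 1 is dropped, and Parseval bounds the finite sum.
    calc ∑ k ∈ F, ((k i : ℝ) ^ 2) ^ s * ‖fourierCoeffVec g k‖ ^ 2
        ≤ ∑ k ∈ F, ‖mFourierCoeff (fun x => toComplexL n (h s x)) k‖ ^ 2 := by
          refine Finset.sum_le_sum fun k _ => ?_
          rw [hco k s, norm_smul, mul_pow, norm_freq_pow_sq]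
          simp only [hg0]
          refine mul_le_mul_of_nonneg_right ?_ (by positivity)
          refine le_mul_of_one_le_left (by positivity) (one_le_pow₀ ?_)
          linarith [Real.pi_gt_three]
      _ ≤ ∫ x, ‖toComplexL n (h s x)‖ ^ 2 ∂(torusMeasure d) :=
          sum_le_hasSum F (fun k _ => by positivity) hP
      _ = ∫ x, ‖h s x‖ ^ 2 ∂(torusMeasure d) := by
          simp only [toComplexL_apply, norm_toComplex]
      _ ≤ _ := hint
  calc _ ≤ ∑ k ∈ F, (d ^ s * ∑ i, ((k i : ℝ) ^ 2) ^ s) * ‖fourierCoeffVec g k‖ ^ 2 := by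
        gcongr with k
        exact sum_sq_pow_le k hs
    _ = d ^ s * ∑ i, ∑ k ∈ F, ((k i : ℝ) ^ 2) ^ s * ‖fourierCoeffVec g k‖ ^ 2 := by
        rw [Finset.sum_comm, Finset.mul_sum]
        refine Finset.sum_congr rfl fun k _ => ?_
        rw [mul_assoc, Finset.sum_mul]
    _ ≤ d ^ s * ∑ _i : Fin d, compConst s B R := by
        gcongr with i
        exact key i
    _ = _ := by simp

end TrigPoly

/-! # The homogeneous Sobolev seminorm -/

section Seminorm

variable {d m n : ℕ}

/-- The weight `|k|^{2s}`. -/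
def freqPow (s : ℕ) (k : Fin d → ℤ) : ℝ := (∑ i, (k i : ℝ) ^ 2) ^ s

lemma freqPow_nonneg (s : ℕ) (k : Fin d → ℤ) : 0 ≤ freqPow s k := by
  unfold freqPow; positivity

lemma freqPow_zero {s : ℕ} (hs : 1 ≤ s) : freqPow s (0 : Fin d → ℤ) = 0 := by
  simp [freqPow, show s ≠ 0 by omega]

lemma norm_pow_le_freqPow (s : ℕ) (k : Fin d → ℤ) : ‖k‖ ^ (2 * s) ≤ freqPow s k := by
  rw [freqPow, pow_mul]
  gcongr
  rw [← Real.le_sqrt (norm_nonneg _), pi_norm_le_iff_of_nonneg (by positivity)]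
  · intro i
    refine Real.le_sqrt_of_sq_le ?_
    rw [Int.norm_eq_abs, sq_abs]
    exact Finset.single_le_sum (f := fun i => (k i : ℝ) ^ 2) (fun _ _ => by positivity)
      (Finset.mem_univ i)
  · positivity

lemma freqPow_pos {s : ℕ} {k : Fin d → ℤ} (hk : k ≠ 0) : 0 < freqPow s k :=
  lt_of_lt_of_le (pow_pos (norm_pos_iff.2 hk) _) (norm_pow_le_freqPow s k)

/-- The bound `∑ |k|^{2s} |f̂(k)|² ≤ R²` on the homogeneous Sobolev seminorm. -/
def SeminormLE (s : ℕ) (f : Torus d → RVec m) (R : ℝ) : Prop :=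
  ∀ F : Finset (Fin d → ℤ), ∑ k ∈ F, freqPow s k * ‖fourierCoeffVec f k‖ ^ 2 ≤ R ^ 2

/-- View ℤ^d as the standard lattice of ℝ^d, of rank d < 2s. The term at k = 0 vanishes because 0⁻¹
= 0 and s ≥ 1. -/
lemma summable_norm_inv_pow {s : ℕ} (hs : (d : ℝ) / 2 < s) :
    Summable fun k : Fin d → ℤ => ‖k‖⁻¹ ^ (2 * s) := by
  let L := Submodule.span ℤ (Set.range (Pi.basisFun ℝ (Fin d)))
  have hrank : Module.finrank ℤ L = d := by
    rw [ZLattice.rank ℝ L]; simp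
  have hds : d < 2 * s := by
    have : (d : ℝ) < 2 * s := by linarith
    exact_mod_cast this
  have h := ZLattice.summable_norm_pow_inv L (2 * s) (by rw [hrank]; exact hds)
  let φ : (Fin d → ℤ) → L := fun k => ⟨fun i => (k i : ℝ), by
    rw [Module.Basis.mem_span_iff_repr_mem]
    intro i
    exact ⟨k i, by simp⟩⟩
  have hφ : Function.Injective φ := by
    intro k l hkl
    funext i
    have : (k i : ℝ) = l i := congrFun (congrArg Subtype.val hkl) i
    exact_mod_cast this
  refine (h.comp_injective hφ).congr fun k => ?_
  change ‖fun i => (k i : ℝ)‖⁻¹ ^ (2 * s) = ‖k‖⁻¹ ^ (2 * s)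
  have h1 : ‖fun i => (k i : ℝ)‖ = ‖k‖ := by
    refine le_antisymm ((pi_norm_le_iff_of_nonneg (norm_nonneg _)).2 fun i => ?_)
      ((pi_norm_le_iff_of_nonneg (norm_nonneg _)).2 fun i => ?_)
    · exact norm_le_pi_norm k i
    · exact norm_le_pi_norm (fun i => (k i : ℝ)) i
  rw [h1]

/-- The lattice sum `∑_{k ≠ 0} |k|_∞^{-2s}`. -/
def latticeSum (d s : ℕ) : ℝ := ∑' k : Fin d → ℤ, ‖k‖⁻¹ ^ (2 * s)

lemma latticeSum_nonneg (d s : ℕ) : 0 ≤ latticeSum d s := tsum_nonneg fun _ => by positivity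

lemma inv_freqPow_le {s : ℕ} (hs : 1 ≤ s) (k : Fin d → ℤ) :
    (freqPow s k)⁻¹ ≤ ‖k‖⁻¹ ^ (2 * s) := by
  rcases eq_or_ne k 0 with rfl | hk
  · simp [freqPow_zero hs]
  · rw [inv_pow]
    exact inv_anti₀ (pow_pos (norm_pos_iff.2 hk) _) (norm_pow_le_freqPow s k)

lemma one_le_of_half_lt {s : ℕ} (hs : (d : ℝ) / 2 < s) : 1 ≤ s := by
  have : (0 : ℝ) < s := lt_of_le_of_lt (by positivity) hs
  exact_mod_cast this

/-- Cauchy–Schwarz with weights |k|^{-2s} and |k|^{2s}: the Sobolev embedding for the part of f of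
mean zero. The mode 0 is excluded because the seminorm does not see it. -/
lemma SeminormLE.sum_norm_le {s : ℕ} (hs : (d : ℝ) / 2 < s) {f : Torus d → RVec m} {R : ℝ}
    (hR : 0 ≤ R) (hf : SeminormLE s f R) {F : Finset (Fin d → ℤ)} (hF : 0 ∉ F) :
    ∑ k ∈ F, ‖fourierCoeffVec f k‖ ≤ Real.sqrt (latticeSum d s) * R := by
  have hs1 := one_le_of_half_lt hs
  have h1 : (∑ k ∈ F, ‖fourierCoeffVec f k‖) ^ 2
      ≤ (∑ k ∈ F, (freqPow s k)⁻¹) * ∑ k ∈ F, freqPow s k * ‖fourierCoeffVec f k‖ ^ 2 := by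
    refine Finset.sum_sq_le_sum_mul_sum_of_sq_le_mul F
      (fun k _ => inv_nonneg.2 (freqPow_nonneg s k))
      (fun k _ => mul_nonneg (freqPow_nonneg s k) (by positivity)) fun k hk => ?_
    have : freqPow s k ≠ 0 := (freqPow_pos fun h => hF (h ▸ hk)).ne'
    rw [inv_mul_cancel_left₀ this]
  have h2 : ∑ k ∈ F, (freqPow s k)⁻¹ ≤ latticeSum d s :=
    (Finset.sum_le_sum fun k _ => inv_freqPow_le hs1 k).trans
      ((summable_norm_inv_pow hs).sum_le_tsum F fun _ _ => by positivity)
  refine (Real.le_sqrt_of_sq_le (h1.trans (mul_le_mul h2 (hf F) (Finset.sum_nonneg fun k _ =>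
    mul_nonneg (freqPow_nonneg s k) (by positivity)) (latticeSum_nonneg d s)))).trans ?_
  rw [Real.sqrt_mul (latticeSum_nonneg d s), Real.sqrt_sq hR]

lemma SeminormLE.summable_norm {s : ℕ} (hs : (d : ℝ) / 2 < s) {f : Torus d → RVec m} {R : ℝ}
    (hR : 0 ≤ R) (hf : SeminormLE s f R) : Summable fun k => ‖fourierCoeffVec f k‖ := by
  refine summable_of_sum_le (c := ‖fourierCoeffVec f 0‖ + Real.sqrt (latticeSum d s) * R)
    (fun _ => norm_nonneg _) fun F => ?_
  calc ∑ k ∈ F, ‖fourierCoeffVec f k‖ ≤ ∑ k ∈ insert 0 (F.erase 0), ‖fourierCoeffVec f k‖ :=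
        Finset.sum_le_sum_of_subset_of_nonneg (fun k hk => by
          by_cases h : k = 0 <;> simp [h, hk]) fun _ _ _ => norm_nonneg _
    _ = ‖fourierCoeffVec f 0‖ + ∑ k ∈ F.erase 0, ‖fourierCoeffVec f k‖ :=
        Finset.sum_insert (by simp)
    _ ≤ _ := by
        gcongr
        exact hf.sum_norm_le hs hR (by simp)

/-- Pointwise Fourier inversion for vector-valued functions. -/
lemma hasSum_mFourier_vec {f : Torus d → RVec m} (hf : Continuous f)
    (hsum : Summable fun k => ‖fourierCoeffVec f k‖) (x : Torus d) :
    HasSum (fun k => mFourier k x • fourierCoeffVec f k) (toComplex (f x)) := by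
  have h1 : Summable fun k => mFourier k x • fourierCoeffVec f k := by
    refine Summable.of_norm ?_
    simpa only [norm_smul, norm_mFourier_apply, one_mul] using hsum
  have hcoord : ∀ (j : Fin m) k, fourierCoeffVec f k j
      = mFourierCoeff (fun x => ((f x j : ℝ) : ℂ)) k :=
    fun j k => fourierCoeffVec_apply ⟨f, hf⟩ k j
  suffices ∑' k, mFourier k x • fourierCoeffVec f k = toComplex (f x) from this ▸ h1.hasSum
  ext j
  let g : C(Torus d, ℂ) := ⟨fun x => ((f x j : ℝ) : ℂ), by fun_prop⟩
  have hg : Summable (mFourierCoeff g) := by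
    refine Summable.of_norm_bounded hsum fun k => ?_
    change ‖mFourierCoeff (fun x => ((f x j : ℝ) : ℂ)) k‖ ≤ _
    rw [← hcoord]
    exact PiLp.norm_apply_le _ j
  have h2 := hasSum_mFourier_series_apply_of_summable hg x
  have h3 := (PiLp.proj (𝕜 := ℂ) 2 (fun _ : Fin m => ℂ) j).hasSum h1.hasSum
  refine h3.unique (h2.congr_fun fun k => ?_)
  change mFourier k x * fourierCoeffVec f k j = _
  rw [hcoord, mul_comm]
  rfl

lemma norm_sub_partialSum_le {f : Torus d → RVec m} (hf : Continuous f)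
    (hsum : Summable fun k => ‖fourierCoeffVec f k‖) (S : Finset (Fin d → ℤ)) (x : Torus d) :
    ‖toComplex (f x) - ∑ k ∈ S, mFourier k x • fourierCoeffVec f k‖
      ≤ ∑' k, ‖fourierCoeffVec f k‖ - ∑ k ∈ S, ‖fourierCoeffVec f k‖ := by
  have h1 : Filter.Tendsto (fun S' => ‖∑ k ∈ S', mFourier k x • fourierCoeffVec f k
      - ∑ k ∈ S, mFourier k x • fourierCoeffVec f k‖) Filter.atTop
      (nhds ‖toComplex (f x) - ∑ k ∈ S, mFourier k x • fourierCoeffVec f k‖) :=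
    (Filter.Tendsto.sub_const (hasSum_mFourier_vec hf hsum x) _).norm
  refine le_of_tendsto h1 ?_
  filter_upwards [Filter.eventually_ge_atTop S] with S' hS'
  rw [← Finset.sum_sdiff hS', add_sub_cancel_right, le_sub_iff_add_le]
  refine le_trans (add_le_add_left (norm_sum_le _ _) _) ?_
  simp only [norm_smul, norm_mFourier_apply, one_mul]
  rw [Finset.sum_sdiff hS']
  exact hsum.sum_le_tsum S' fun _ _ => norm_nonneg _

/-- The bound on first derivatives makes `B` a Lipschitz constant common to all networks; the
constant in `Activation.lipschitz` would depend on the activation. -/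
lemma norm_sub_le_of_derivBounded {s : ℕ} (hs : 1 ≤ s) {σ : RVec m → RVec n}
    (hσ : ContDiff ℝ ∞ σ) {B : ℝ}
    (hσB : ∀ j : ℕ, 1 ≤ j → j ≤ s → ∀ y, ‖iteratedFDeriv ℝ j σ y‖ ≤ B) (y z : RVec m) :
    ‖σ y - σ z‖ ≤ B * ‖y - z‖ := by
  refine Convex.norm_image_sub_le_of_norm_fderiv_le (𝕜 := ℝ) (s := Set.univ)
    (fun w _ => hσ.differentiable (by simp) w) (fun w _ => ?_) convex_univ trivial trivial
  rw [← norm_iteratedFDeriv_one]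
  exact hσB 1 le_rfl hs w

/-- The bound on the Sobolev seminorm of a composition. -/
def compRadius (d s : ℕ) (B R : ℝ) : ℝ :=
  Real.sqrt (d ^ s * (d * compConst s B
    (1 + Real.sqrt (latticeSum d s) * R + (2 * Real.pi) ^ s * R)))

lemma compRadius_nonneg (d s : ℕ) (B R : ℝ) : 0 ≤ compRadius d s B R := Real.sqrt_nonneg _

lemma compConst_nonneg (s : ℕ) {B R : ℝ} : 0 ≤ compConst s B R := by
  have := Finset.sum_nonneg fun a (_ : a ∈ Finset.Icc 1 s) => gnConst_nonneg s a
  have h2 : 0 ≤ R ^ (2 * s) := by rw [pow_mul]; positivity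
  unfold compConst
  positivity

/-- **Composition estimate**: a smooth map whose derivatives of orders `1, …, s` are bounded maps
`Hˢ` functions to `Hˢ` functions, with control of the homogeneous seminorms only. -/
theorem SeminormLE.comp {s : ℕ} (hs : (d : ℝ) / 2 < s) {σ : RVec m → RVec n}
    (hσ : ContDiff ℝ ∞ σ) {B : ℝ} (hB : 0 ≤ B)
    (hσB : ∀ j : ℕ, 1 ≤ j → j ≤ s → ∀ y, ‖iteratedFDeriv ℝ j σ y‖ ≤ B)
    {f : Torus d → RVec m} (hfc : Continuous f) {R : ℝ} (hR : 0 ≤ R) (hf : SeminormLE s f R) :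
    SeminormLE s (fun x => σ (f x)) (compRadius d s B R) := by
  intro F
  have hs1 := one_le_of_half_lt hs
  have hsum := hf.summable_norm hs hR
  -- `R'` dominates 1, the sup norm of f minus its mean, and the L² norm of its `s`-th derivatives
  -- in each coordinate.
  set R' := 1 + Real.sqrt (latticeSum d s) * R + (2 * Real.pi) ^ s * R with hR'
  have p1 : 0 ≤ Real.sqrt (latticeSum d s) * R := by positivity
  have p2 : 0 ≤ (2 * Real.pi) ^ s * R := by positivity
  rw [compRadius, Real.sq_sqrt (by have := compConst_nonneg s (B := B) (R := R'); positivity)]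
  -- The mean is moved into a translation of σ, which leaves its derivative bounds unchanged; the
  -- remaining polynomial has no mode 0.
  let b := rePart (fourierCoeffVec f 0)
  let g : Finset (Fin d → ℤ) → Torus d → RVec n := fun S x =>
    σ (b + rePart (∑ k ∈ S.erase 0, mFourier k x • fourierCoeffVec f k))
  have hbound : ∀ S, ∑ k ∈ F, freqPow s k * ‖fourierCoeffVec (g S) k‖ ^ 2
      ≤ d ^ s * (d * compConst s B R') := by
    intro S
    refine sum_sobolev_comp_trigPoly_le hs1 hσ hB hσB b (S.erase 0) (fourierCoeffVec f)
      (by linarith) ((hf.sum_norm_le hs hR (by simp)).trans (by linarith)) ?_ F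
    calc _ ≤ (2 * Real.pi) ^ (2 * s) * R ^ 2 := by
          gcongr; exact hf _
      _ = ((2 * Real.pi) ^ s * R) ^ 2 := by ring
      _ ≤ R' ^ 2 := by gcongr; linarith
  have hclose : ∀ S : Finset (Fin d → ℤ), 0 ∈ S → ∀ k,
      ‖fourierCoeffVec (g S) k - fourierCoeffVec (fun x => σ (f x)) k‖
        ≤ B * (∑' k, ‖fourierCoeffVec f k‖ - ∑ k ∈ S, ‖fourierCoeffVec f k‖) := by
    intro S hS k
    have hgc : Continuous (g S) := hσ.continuous.comp
      (continuous_const.add (continuous_rePart.comp (continuous_trigPoly _ _)))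
    rw [fourierCoeffVec, fourierCoeffVec, ← mFourierCoeff_sub_fun
      (f := fun x => toComplex (g S x)) (g := fun x => toComplex (σ (f x)))
      (continuous_toComplex.comp hgc) (continuous_toComplex.comp (hσ.continuous.comp hfc))]
    refine norm_mFourierCoeff_le (fun x => ?_) k
    rw [← toComplexL_apply, ← toComplexL_apply, ← map_sub, toComplexL_apply, norm_toComplex]
    refine (norm_sub_le_of_derivBounded hs1 hσ hσB _ _).trans
      (mul_le_mul_of_nonneg_left ?_ hB)
    have e1 : b + rePart (∑ k ∈ S.erase 0, mFourier k x • fourierCoeffVec f k)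
        = rePart (∑ k ∈ S, mFourier k x • fourierCoeffVec f k) := by
      rw [← Finset.add_sum_erase S _ hS, ← rePartL_apply, ← rePartL_apply, map_add,
        mFourier_zero]
      simp [b, rePartL_apply]
    rw [e1, ← rePart_toComplex (f x), ← rePartL_apply, ← rePartL_apply, ← map_sub, rePartL_apply]
    refine (norm_rePart_le _).trans ?_
    rw [norm_sub_rev]
    exact norm_sub_partialSum_le hfc hsum S x
  have hlim : ∀ k, Filter.Tendsto (fun S => fourierCoeffVec (g S) k) Filter.atTop
      (nhds (fourierCoeffVec (fun x => σ (f x)) k)) := by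
    intro k
    rw [tendsto_iff_norm_sub_tendsto_zero]
    have h0 : Filter.Tendsto (fun S : Finset (Fin d → ℤ) =>
        B * (∑' k, ‖fourierCoeffVec f k‖ - ∑ k ∈ S, ‖fourierCoeffVec f k‖)) Filter.atTop
        (nhds 0) := by
      have := (Filter.Tendsto.const_sub (∑' k, ‖fourierCoeffVec f k‖) hsum.hasSum).const_mul B
      simpa using this
    refine squeeze_zero' (Filter.Eventually.of_forall fun _ => norm_nonneg _) ?_ h0
    filter_upwards [Filter.eventually_ge_atTop {0}] with S hS
    exact hclose S (hS (by simp)) k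
  -- Each coefficient converges, because f is a uniform limit of its partial sums and σ is
  -- Lipschitz; so the finite sum inherits the uniform bound.
  refine le_of_tendsto (tendsto_finsetSum F fun k _ =>
    ((hlim k).norm.pow 2).const_mul (freqPow s k)) (Filter.Eventually.of_forall hbound)

end Seminorm

/-! # Discrete Fourier analysis on the grid -/

section Discrete

variable {d m N : ℕ}

lemma mem_symmIndex {k : ℤ} : k ∈ symmIndex N ↔ -(N : ℤ) ≤ 2 * k ∧ 2 * k < N := by
  unfold symmIndex
  split_ifs with h
  · obtain ⟨L, rfl⟩ := h
    rw [Finset.mem_Icc]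
    omega
  · obtain ⟨L, rfl⟩ := Nat.not_odd_iff_even.1 h
    rw [Finset.mem_Ico]
    omega

lemma mem_modes {k : Fin d → ℤ} : k ∈ modes d N ↔ ∀ i, -(N : ℤ) ≤ 2 * k i ∧ 2 * k i < N := by
  simp only [modes, Fintype.mem_piFinset, mem_symmIndex]

lemma modes_subset {K : ℕ} (h : K ≤ N) : modes d K ⊆ modes d N := by
  intro k hk
  rw [mem_modes] at hk ⊢
  intro i
  have := hk i
  omega

lemma eq_of_mem_modes_of_dvd {j k : Fin d → ℤ} (hj : j ∈ modes d N) (hk : k ∈ modes d N)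
    (h : ∀ i, (N : ℤ) ∣ j i - k i) : j = k := by
  rw [mem_modes] at hj hk
  funext i
  have h1 := hj i
  have h2 := hk i
  have := Int.eq_zero_of_abs_lt_dvd (h i) (by rw [abs_lt]; omega)
  omega

lemma two_mul_norm_le_of_mem_modes {k : Fin d → ℤ} (hk : k ∈ modes d N) : ‖k‖ ≤ N / 2 := by
  rw [pi_norm_le_iff_of_nonneg (by positivity)]
  intro i
  have h1 := mem_modes.1 hk i
  have h2 : 2 * |k i| ≤ N := by
    rcases abs_cases (k i) with h | h <;> omega
  rw [Int.norm_eq_abs]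
  have h3 : (2 : ℝ) * |(k i : ℝ)| ≤ N := by exact_mod_cast h2
  linarith

lemma le_norm_of_notMem_modes {k : Fin d → ℤ} (hk : k ∉ modes d N) : (N : ℝ) / 2 ≤ ‖k‖ := by
  rw [mem_modes] at hk
  push Not at hk
  obtain ⟨i, hi⟩ := hk
  have h2 : (N : ℤ) ≤ 2 * |k i| := by
    by_cases h : -(N : ℤ) ≤ 2 * k i
    · have := hi h
      have := le_abs_self (k i)
      omega
    · have := neg_le_abs (k i)
      omega
  have h3 : (N : ℝ) ≤ 2 * |(k i : ℝ)| := by exact_mod_cast h2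
  have h4 := norm_le_pi_norm k i
  rw [Int.norm_eq_abs] at h4
  linarith

lemma sum_exp_grid (hN : 0 < N) (k : ℤ) :
    ∑ j : Fin N, Complex.exp (2 * Real.pi * Complex.I * k * ((j : ℕ) / N : ℝ))
      = if (N : ℤ) ∣ k then (N : ℂ) else 0 := by
  have hN' : (N : ℂ) ≠ 0 := by exact_mod_cast hN.ne'
  set ζ := Complex.exp (2 * Real.pi * Complex.I * k / N) with hζ
  have h1 : ∀ j : ℕ, Complex.exp (2 * Real.pi * Complex.I * k * ((j : ℕ) / N : ℝ)) = ζ ^ j := by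
    intro j
    rw [hζ, ← Complex.exp_nat_mul]
    congr 1
    push_cast
    ring
  simp only [h1]
  rw [Fin.sum_univ_eq_sum_range (fun j => ζ ^ j) N]
  have hζN : ζ ^ N = 1 := by
    rw [hζ, ← Complex.exp_nat_mul, Complex.exp_eq_one_iff]
    exact ⟨k, by field_simp⟩
  have hζ1 : ζ = 1 ↔ (N : ℤ) ∣ k := by
    rw [hζ, Complex.exp_eq_one_iff]
    constructor
    · rintro ⟨l, hl⟩
      refine ⟨l, ?_⟩
      have h2 : (2 * Real.pi * Complex.I : ℂ) ≠ 0 := by simp [Real.pi_ne_zero]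
      have h3 : (2 * Real.pi * Complex.I : ℂ) * k = (2 * Real.pi * Complex.I : ℂ) * (N * l) := by
        field_simp at hl
        linear_combination (2 * Real.pi * Complex.I : ℂ) * hl
      have h4 := mul_left_cancel₀ h2 h3
      exact_mod_cast h4
    · rintro ⟨l, rfl⟩
      exact ⟨l, by push_cast; field_simp⟩
  split_ifs with h
  · simp [hζ1.2 h]
  · have h5 := mul_neg_geom_sum ζ N
    rw [hζN, sub_self] at h5
    refine (mul_eq_zero.1 h5).resolve_left ?_
    exact fun h' => h (hζ1.1 (sub_eq_zero.1 h').symm)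

lemma mFourier_gridPoint (k : Fin d → ℤ) (n : Fin d → Fin N) :
    mFourier k (gridPoint n)
      = ∏ i, Complex.exp (2 * Real.pi * Complex.I * k i * ((n i : ℕ) / N : ℝ)) := by
  simp only [mFourier, ContinuousMap.coe_mk, gridPoint]
  refine Finset.prod_congr rfl fun i _ => ?_
  rw [fourier_coe_apply]
  simp

/-- Orthogonality of the Fourier monomials on the grid. -/
lemma sum_mFourier_gridPoint (hN : 0 < N) (k : Fin d → ℤ) :
    ∑ n : Fin d → Fin N, mFourier k (gridPoint n)
      = if ∀ i, (N : ℤ) ∣ k i then (N : ℂ) ^ d else 0 := by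
  simp only [mFourier_gridPoint]
  have h := Finset.prod_univ_sum (fun _ : Fin d => (Finset.univ : Finset (Fin N)))
    (fun i (j : Fin N) => Complex.exp (2 * Real.pi * Complex.I * k i * ((j : ℕ) / N : ℝ)))
  rw [Fintype.piFinset_univ] at h
  rw [← h]
  simp only [sum_exp_grid hN]
  split_ifs with h1
  · simp [h1]
  · push Not at h1
    obtain ⟨i, hi⟩ := h1
    exact Finset.prod_eq_zero (Finset.mem_univ i) (if_neg hi)

/-- The discrete Fourier transform of complex grid values. -/
def complexDFT (w : (Fin d → Fin N) → CVec m) (k : Fin d → ℤ) : CVec m :=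
  ((N : ℂ) ^ d)⁻¹ • ∑ n : Fin d → Fin N, mFourier (-k) (gridPoint n) • w n

lemma DFT_eq_complexDFT (u : (Fin d → Fin N) → RVec m) (k : Fin d → ℤ) :
    DFT u k = complexDFT (fun n => toComplex (u n)) k := rfl

lemma complexDFT_mFourier (hN : 0 < N) (j : Fin d → ℤ) (c : CVec m) (k : Fin d → ℤ) :
    complexDFT (N := N) (fun n => mFourier j (gridPoint n) • c) k
      = if ∀ i, (N : ℤ) ∣ j i - k i then c else 0 := by
  have hN' : (N : ℂ) ^ d ≠ 0 := pow_ne_zero _ (by exact_mod_cast hN.ne')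
  simp only [complexDFT, smul_smul, ← mFourier_add]
  rw [← Finset.sum_smul, sum_mFourier_gridPoint hN, smul_smul]
  simp only [Pi.add_apply, Pi.neg_apply, neg_add_eq_sub]
  split_ifs with h
  · rw [inv_mul_cancel₀ hN', one_smul]
  · simp

lemma DFT_sub (u v : (Fin d → Fin N) → RVec m) (k : Fin d → ℤ) :
    DFT (fun n => u n - v n) k = DFT u k - DFT v k := by
  simp only [DFT, ← toComplexL_apply, map_sub, smul_sub, Finset.sum_sub_distrib]

/-- The normalized squared `ℓ²` norm of grid values. -/
def gridSq {E : Type*} [NormedAddCommGroup E] (w : (Fin d → Fin N) → E) : ℝ :=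
  ((N : ℝ) ^ d)⁻¹ * ∑ n, ‖w n‖ ^ 2

open scoped InnerProductSpace in
lemma sum_inner_trigPoly_grid (hN : 0 < N) {S : Finset (Fin d → ℤ)} (hS : S ⊆ modes d N)
    (c : (Fin d → ℤ) → CVec m) :
    ∑ n : Fin d → Fin N, ⟪∑ k ∈ S, mFourier k (gridPoint n) • c k,
        ∑ k ∈ S, mFourier k (gridPoint n) • c k⟫_ℂ
      = (N : ℂ) ^ d * ∑ k ∈ S, ⟪c k, c k⟫_ℂ := by
  simp only [sum_inner, inner_sum, inner_smul_left, inner_smul_right, ← mFourier_neg]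
  rw [Finset.sum_comm, Finset.mul_sum]
  refine Finset.sum_congr rfl fun k hk => ?_
  simp only [Finset.mul_sum]
  rw [Finset.sum_comm, Finset.sum_eq_single k]
  · simp only [← mul_assoc, ← mFourier_add]
    rw [← Finset.sum_mul, sum_mFourier_gridPoint hN]
    simp
  · intro l hl hlk
    simp only [← mul_assoc, ← mFourier_add]
    rw [← Finset.sum_mul, sum_mFourier_gridPoint hN, if_neg, zero_mul]
    intro h
    exact hlk (eq_of_mem_modes_of_dvd (hS hl) (hS hk) fun i => by
      have := h i
      rw [dvd_sub_comm]
      simpa [sub_eq_add_neg] using this)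
  · exact fun h => absurd hk h

/-- Parseval on the grid: frequencies in [[N]]^d are pairwise distinct modulo N, so their monomials
stay orthogonal there. -/
lemma gridSq_trigPoly (hN : 0 < N) {S : Finset (Fin d → ℤ)} (hS : S ⊆ modes d N)
    (c : (Fin d → ℤ) → CVec m) :
    gridSq (fun n : Fin d → Fin N => ∑ k ∈ S, mFourier k (gridPoint n) • c k)
      = ∑ k ∈ S, ‖c k‖ ^ 2 := by
  have hN' : (N : ℝ) ^ d ≠ 0 := pow_ne_zero _ (by exact_mod_cast hN.ne')
  have h := sum_inner_trigPoly_grid hN hS c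
  simp only [inner_self_eq_norm_sq_to_K] at h
  rw [gridSq, inv_mul_eq_iff_eq_mul₀ hN']
  refine Complex.ofReal_injective ?_
  push_cast
  exact h

open scoped InnerProductSpace in
/-- Bessel's inequality for the discrete Fourier transform. -/
lemma sum_norm_sq_complexDFT_le (hN : 0 < N) (w : (Fin d → Fin N) → CVec m) :
    ∑ k ∈ modes d N, ‖complexDFT w k‖ ^ 2 ≤ gridSq w := by
  have hN' : (0 : ℝ) < (N : ℝ) ^ d := by positivity
  have hNC : (N : ℂ) ^ d ≠ 0 := pow_ne_zero _ (by exact_mod_cast hN.ne')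
  let p : (Fin d → Fin N) → CVec m := fun n =>
    ∑ k ∈ modes d N, mFourier k (gridPoint n) • complexDFT w k
  have h1 : ∑ n, ‖p n‖ ^ 2 = (N : ℝ) ^ d * ∑ k ∈ modes d N, ‖complexDFT w k‖ ^ 2 := by
    rw [← gridSq_trigPoly hN (subset_refl (modes d N)) (complexDFT w), gridSq,
      mul_inv_cancel_left₀ hN'.ne']
  have h2 : ∑ n, ⟪p n, w n⟫_ℂ = ((N : ℝ) ^ d * ∑ k ∈ modes d N, ‖complexDFT w k‖ ^ 2 : ℝ) := by
    simp only [p, sum_inner, inner_smul_left, ← mFourier_neg]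
    rw [Finset.sum_comm]
    push_cast
    rw [Finset.mul_sum]
    refine Finset.sum_congr rfl fun k _ => ?_
    simp only [← inner_smul_right]
    rw [← inner_sum]
    have e : ∑ n, mFourier (-k) (gridPoint n) • w n = (N : ℂ) ^ d • complexDFT w k := by
      rw [complexDFT, smul_smul, mul_inv_cancel₀ hNC, one_smul]
    rw [e, inner_smul_right, inner_self_eq_norm_sq_to_K]
    rfl
  have h3 : ∑ n, (⟪p n, w n⟫_ℂ).re = (N : ℝ) ^ d * ∑ k ∈ modes d N, ‖complexDFT w k‖ ^ 2 := by
    rw [← Complex.re_sum, h2, Complex.ofReal_re]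
  -- By `h1` and `h3`, ∑ |p|² and ∑ Re⟨p, w⟩ agree, so expanding ∑ |p - w|² ≥ 0 leaves ∑ |w|² - ∑
  -- |p|² ≥ 0.
  have h4 : ∀ n, ‖p n - w n‖ ^ 2 = ‖p n‖ ^ 2 - 2 * (⟪p n, w n⟫_ℂ).re + ‖w n‖ ^ 2 :=
    fun n => norm_sub_sq (𝕜 := ℂ) _ _
  have h5 : 0 ≤ ∑ n, ‖p n - w n‖ ^ 2 := Finset.sum_nonneg fun _ _ => by positivity
  simp only [h4, Finset.sum_add_distrib, Finset.sum_sub_distrib, ← Finset.mul_sum] at h5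
  rw [gridSq, le_inv_mul_iff₀ hN']
  linarith

lemma sum_norm_sq_DFT_le (hN : 0 < N) (u : (Fin d → Fin N) → RVec m) :
    ∑ k ∈ modes d N, ‖DFT u k‖ ^ 2 ≤ gridSq u := by
  simp only [DFT_eq_complexDFT]
  refine (sum_norm_sq_complexDFT_le hN _).trans_eq ?_
  simp only [gridSq, norm_toComplex]

/-! # Aliasing -/

/-- The frequencies which agree with `k` on the grid. -/
def aliasFreq (N : ℕ) (k l : Fin d → ℤ) : Fin d → ℤ := fun i => k i + N * l i

lemma aliasFreq_injective (hN : 0 < N) (k : Fin d → ℤ) : Function.Injective (aliasFreq N k) := by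
  intro l l' h
  funext i
  have h1 := congrFun h i
  simp only [aliasFreq, add_right_inj] at h1
  exact mul_left_cancel₀ (by exact_mod_cast hN.ne') h1

lemma aliasFreq_injOn (hN : 0 < N) {k k' l l' : Fin d → ℤ} (hk : k ∈ modes d N)
    (hk' : k' ∈ modes d N) (h : aliasFreq N k l = aliasFreq N k' l') : k = k' ∧ l = l' := by
  have h1 : k = k' := eq_of_mem_modes_of_dvd hk hk' fun i => by
    have h2 := congrFun h i
    simp only [aliasFreq] at h2
    exact ⟨l' i - l i, by linear_combination h2⟩
  subst h1
  exact ⟨rfl, aliasFreq_injective hN k h⟩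

/-- The aliasing formula for the discrete Fourier transform. -/
lemma hasSum_DFT (hN : 0 < N) {f : Torus d → RVec m} (hf : Continuous f)
    (hsum : Summable fun k => ‖fourierCoeffVec f k‖) (k : Fin d → ℤ) :
    HasSum (fun l => fourierCoeffVec f (aliasFreq N k l))
      (DFT (fun n : Fin d → Fin N => f (gridPoint n)) k) := by
  -- Apply the DFT termwise to the Fourier series: a monomial of frequency `j` contributes exactly
  -- when j ≡ k modulo N.
  have h1 : HasSum (fun j => if ∀ i, (N : ℤ) ∣ j i - k i then fourierCoeffVec f j else 0)
      (DFT (fun n : Fin d → Fin N => f (gridPoint n)) k) := by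
    simp only [← complexDFT_mFourier hN]
    unfold complexDFT DFT
    exact (hasSum_sum fun n _ =>
      (hasSum_mFourier_vec hf hsum (gridPoint n)).const_smul _).const_smul _
  have h2 : (fun l => fourierCoeffVec f (aliasFreq N k l))
      = (fun j => if ∀ i, (N : ℤ) ∣ j i - k i then fourierCoeffVec f j else 0)
        ∘ aliasFreq N k := by
    funext l
    simp [aliasFreq]
  rw [h2, (aliasFreq_injective hN k).hasSum_iff]
  · exact h1
  · intro j hj
    refine if_neg fun h => hj ?_
    choose l hl using h
    exact ⟨l, funext fun i => by simp only [aliasFreq, ← hl i]; ring⟩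

/-- ‖k‖ ≤ N/2 and ‖l‖ ≥ 1, so ‖k + N l‖ ≥ N‖l‖ - N/2 ≥ N‖l‖/2. -/
lemma norm_aliasFreq_ge {k l : Fin d → ℤ} (hk : k ∈ modes d N) (hl : l ≠ 0) :
    (N : ℝ) / 2 * ‖l‖ ≤ ‖aliasFreq N k l‖ := by
  have h1 : (1 : ℝ) ≤ ‖l‖ := by
    obtain ⟨i, hi⟩ := Function.ne_iff.1 hl
    refine le_trans ?_ (norm_le_pi_norm l i)
    rw [Int.norm_eq_abs]
    exact_mod_cast Int.one_le_abs hi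
  have h2 : aliasFreq N k l = k + (N : ℤ) • l := by
    funext i; simp [aliasFreq]
  have h3 : ‖(N : ℤ) • l‖ = N * ‖l‖ := by
    rw [norm_smul]; simp
  have h4 := norm_sub_le (k + (N : ℤ) • l) k
  rw [add_sub_cancel_left, h3] at h4
  have h5 := two_mul_norm_le_of_mem_modes hk
  rw [h2]
  have h6 : (0 : ℝ) ≤ N := by positivity
  nlinarith

lemma sum_inv_freqPow_aliasFreq_le (hN : 0 < N) {s : ℕ} (hs : (d : ℝ) / 2 < s)
    {k : Fin d → ℤ} (hk : k ∈ modes d N) {G : Finset (Fin d → ℤ)} (hG : 0 ∉ G) :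
    ∑ l ∈ G, (freqPow s (aliasFreq N k l))⁻¹ ≤ (2 / N) ^ (2 * s) * latticeSum d s := by
  have hN' : (0 : ℝ) < N := by exact_mod_cast hN
  calc ∑ l ∈ G, (freqPow s (aliasFreq N k l))⁻¹
      ≤ ∑ l ∈ G, (2 / N : ℝ) ^ (2 * s) * ‖l‖⁻¹ ^ (2 * s) := by
        refine Finset.sum_le_sum fun l hl => ?_
        have hl0 : l ≠ 0 := fun h => hG (h ▸ hl)
        have hp := norm_pos_iff.2 hl0
        refine (inv_freqPow_le (one_le_of_half_lt hs) _).trans ?_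
        rw [← mul_pow]
        refine pow_le_pow_left₀ (by positivity) ?_ _
        calc ‖aliasFreq N k l‖⁻¹ ≤ ((N : ℝ) / 2 * ‖l‖)⁻¹ :=
              inv_anti₀ (by positivity) (norm_aliasFreq_ge hk hl0)
          _ = _ := by rw [mul_inv, inv_div]
    _ = (2 / N : ℝ) ^ (2 * s) * ∑ l ∈ G, ‖l‖⁻¹ ^ (2 * s) := by rw [Finset.mul_sum]
    _ ≤ _ := by
        gcongr
        exact (summable_norm_inv_pow hs).sum_le_tsum G fun _ _ => by positivity

lemma freqPow_aliasFreq_ne_zero {s : ℕ} (hN : 0 < N) {k l : Fin d → ℤ} (hk : k ∈ modes d N)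
    (hl : l ≠ 0) : freqPow s (aliasFreq N k l) ≠ 0 := by
  refine (freqPow_pos ?_).ne'
  have h1 := norm_aliasFreq_ge hk hl
  have h2 := norm_pos_iff.2 hl
  have hN' : (0 : ℝ) < N := by exact_mod_cast hN
  exact norm_pos_iff.1 (lt_of_lt_of_le (by positivity) h1)

/-- The `ℓ²` aliasing error of the discrete Fourier transform. -/
lemma sum_aliasing_le (hN : 0 < N) {s : ℕ} (hs : (d : ℝ) / 2 < s) {f : Torus d → RVec m}
    (hf : Continuous f) {R : ℝ} (hR : 0 ≤ R) (hfR : SeminormLE s f R) :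
    ∑ k ∈ modes d N, ‖fourierCoeffVec f k - DFT (fun n : Fin d → Fin N => f (gridPoint n)) k‖ ^ 2
      ≤ (2 / N) ^ (2 * s) * latticeSum d s * R ^ 2 := by
  have hsum := hfR.summable_norm hs hR
  have hlim : ∀ k, Filter.Tendsto
      (fun G : Finset (Fin d → ℤ) => ∑ l ∈ G.erase 0, fourierCoeffVec f (aliasFreq N k l))
      Filter.atTop
      (nhds (DFT (fun n : Fin d → Fin N => f (gridPoint n)) k - fourierCoeffVec f k)) := by
    intro k
    refine (Filter.Tendsto.sub_const (hasSum_DFT hN hf hsum k) (fourierCoeffVec f k)).congr' ?_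
    filter_upwards [Filter.eventually_ge_atTop {0}] with G hG
    have h0 : (0 : Fin d → ℤ) ∈ G := hG (by simp)
    rw [← Finset.add_sum_erase G _ h0]
    have : aliasFreq N k 0 = k := by funext i; simp [aliasFreq]
    rw [this, add_sub_cancel_left]
  have hlim2 := tendsto_finsetSum (modes d N) fun k _ => (hlim k).norm.pow 2
  simp only [norm_sub_rev (DFT _ _)] at hlim2
  refine le_of_tendsto hlim2 (Filter.Eventually.of_forall fun G => ?_)
  calc ∑ k ∈ modes d N, ‖∑ l ∈ G.erase 0, fourierCoeffVec f (aliasFreq N k l)‖ ^ 2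
      ≤ ∑ k ∈ modes d N, (2 / N) ^ (2 * s) * latticeSum d s * ∑ l ∈ G.erase 0,
          freqPow s (aliasFreq N k l) * ‖fourierCoeffVec f (aliasFreq N k l)‖ ^ 2 := by
        refine Finset.sum_le_sum fun k hk => ?_
        have h1 : (∑ l ∈ G.erase 0, ‖fourierCoeffVec f (aliasFreq N k l)‖) ^ 2
            ≤ (∑ l ∈ G.erase 0, (freqPow s (aliasFreq N k l))⁻¹) * ∑ l ∈ G.erase 0,
              freqPow s (aliasFreq N k l) * ‖fourierCoeffVec f (aliasFreq N k l)‖ ^ 2 := by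
          refine Finset.sum_sq_le_sum_mul_sum_of_sq_le_mul _
            (fun l _ => inv_nonneg.2 (freqPow_nonneg s _))
            (fun l _ => mul_nonneg (freqPow_nonneg s _) (by positivity)) fun l hl => ?_
          rw [inv_mul_cancel_left₀
            (freqPow_aliasFreq_ne_zero hN hk (Finset.ne_of_mem_erase hl))]
        refine le_trans (pow_le_pow_left₀ (norm_nonneg _) (norm_sum_le _ _) 2) (h1.trans ?_)
        exact mul_le_mul_of_nonneg_right (sum_inv_freqPow_aliasFreq_le hN hs hk (by simp))
          (Finset.sum_nonneg fun l _ => mul_nonneg (freqPow_nonneg s _) (by positivity))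
    -- The map (k, l) ↦ k + N l is injective for `k` in [[N]]^d, so the double sum is one finite sum
    -- of the seminorm and no frequency is counted twice.
    _ = (2 / N) ^ (2 * s) * latticeSum d s *
          ∑ j ∈ (modes d N ×ˢ G.erase 0).image fun z => aliasFreq N z.1 z.2,
            freqPow s j * ‖fourierCoeffVec f j‖ ^ 2 := by
        rw [← Finset.mul_sum, Finset.sum_image, Finset.sum_product]
        rintro ⟨k, l⟩ hkl ⟨k', l'⟩ hkl' h
        simp only [Finset.coe_product, Set.mem_prod, Finset.mem_coe] at hkl hkl'
        obtain ⟨rfl, rfl⟩ := aliasFreq_injOn hN hkl.1 hkl'.1 h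
        rfl
    _ ≤ _ := mul_le_mul_of_nonneg_left (hfR _)
        (mul_nonneg (by positivity) (latticeSum_nonneg d s))

lemma norm_sub_sq_le_two_mul {E : Type*} [SeminormedAddCommGroup E] (x y z : E) :
    ‖x - z‖ ^ 2 ≤ 2 * ‖x - y‖ ^ 2 + 2 * ‖y - z‖ ^ 2 := by
  have h := norm_sub_le_norm_sub_add_norm_sub x y z
  nlinarith [norm_nonneg (x - z), sq_nonneg (‖x - y‖ - ‖y - z‖)]

/-- The `ℓ²` distance between the Fourier coefficients of `f` and the discrete Fourier transform
of approximate grid values of `f`. -/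
lemma sum_norm_sq_sub_DFT_le (hN : 0 < N) {s : ℕ} (hs : (d : ℝ) / 2 < s) {f : Torus d → RVec m}
    (hf : Continuous f) {R : ℝ} (hR : 0 ≤ R) (hfR : SeminormLE s f R)
    (u : (Fin d → Fin N) → RVec m) :
    ∑ k ∈ modes d N, ‖fourierCoeffVec f k - DFT u k‖ ^ 2
      ≤ 2 * ((2 / N) ^ (2 * s) * latticeSum d s * R ^ 2)
        + 2 * gridSq (fun n => f (gridPoint n) - u n) := by
  have h1 := sum_aliasing_le hN hs hf hR hfR
  have h2 := sum_norm_sq_DFT_le hN (fun n => f (gridPoint n) - u n)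
  simp only [DFT_sub] at h2
  calc _ ≤ ∑ k ∈ modes d N,
        (2 * ‖fourierCoeffVec f k - DFT (fun n : Fin d → Fin N => f (gridPoint n)) k‖ ^ 2
          + 2 * ‖DFT (fun n : Fin d → Fin N => f (gridPoint n)) k - DFT u k‖ ^ 2) :=
        Finset.sum_le_sum fun k _ => norm_sub_sq_le_two_mul _ _ _
    _ ≤ _ := by
        rw [Finset.sum_add_distrib, ← Finset.mul_sum, ← Finset.mul_sum]
        linarith

/-- The truncation error: outside [[N]]^d, ‖k‖ ≥ N/2 and hence 1 ≤ (2/N)^{2s} |k|^{2s}. -/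
lemma sum_norm_sq_le_of_disjoint_modes (hN : 0 < N) {s : ℕ} {f : Torus d → RVec m} {R : ℝ}
    (hfR : SeminormLE s f R) {F : Finset (Fin d → ℤ)} (hF : ∀ k ∈ F, k ∉ modes d N) :
    ∑ k ∈ F, ‖fourierCoeffVec f k‖ ^ 2 ≤ (2 / N) ^ (2 * s) * R ^ 2 := by
  have hN' : (0 : ℝ) < N := by exact_mod_cast hN
  calc ∑ k ∈ F, ‖fourierCoeffVec f k‖ ^ 2
      ≤ ∑ k ∈ F, (2 / N : ℝ) ^ (2 * s) * (freqPow s k * ‖fourierCoeffVec f k‖ ^ 2) := by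
        refine Finset.sum_le_sum fun k hk => ?_
        rw [← mul_assoc]
        refine le_mul_of_one_le_left (by positivity) ?_
        have h1 := le_norm_of_notMem_modes (hF k hk)
        calc (1 : ℝ) = (2 / N : ℝ) ^ (2 * s) * (N / 2 : ℝ) ^ (2 * s) := by
              rw [← mul_pow]; field_simp; simp
          _ ≤ (2 / N : ℝ) ^ (2 * s) * freqPow s k := by
              refine mul_le_mul_of_nonneg_left ?_ (by positivity)
              exact (pow_le_pow_left₀ (by positivity) h1 _).trans (norm_pow_le_freqPow s k)
    _ ≤ _ := by
        rw [← Finset.mul_sum]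
        exact mul_le_mul_of_nonneg_left (hfR F) (by positivity)

lemma continuous_trigInterp (u : (Fin d → Fin N) → RVec m) : Continuous (trigInterp u) :=
  continuous_trigPoly (modes d N) (DFT u)

/-- The `L²` distance between `f` and the trigonometric interpolant of approximate grid values. -/
lemma integral_norm_sq_sub_trigInterp_le (hN : 0 < N) {s : ℕ} (hs : (d : ℝ) / 2 < s)
    {f : Torus d → RVec m} (hf : Continuous f) {R : ℝ} (hR : 0 ≤ R) (hfR : SeminormLE s f R)
    (u : (Fin d → Fin N) → RVec m) :
    ∫ x, ‖toComplex (f x) - trigInterp u x‖ ^ 2 ∂(torusMeasure d)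
      ≤ 2 * ((2 / N) ^ (2 * s) * latticeSum d s * R ^ 2)
        + 2 * gridSq (fun n => f (gridPoint n) - u n) + (2 / N) ^ (2 * s) * R ^ 2 := by
  have hfc : Continuous fun x => toComplex (f x) := continuous_toComplex.comp hf
  have hP := parseval (hfc.sub (continuous_trigInterp u))
  refine hasSum_le_of_sum_le hP fun F => ?_
  have hco : ∀ k, mFourierCoeff (fun x => toComplex (f x) - trigInterp u x) k
      = fourierCoeffVec f k - if k ∈ modes d N then DFT u k else 0 := by
    intro k
    rw [mFourierCoeff_sub_fun hfc (continuous_trigInterp u)]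
    congr 1
    exact mFourierCoeff_trigPoly (modes d N) (DFT u) k
  change ∑ k ∈ F, ‖mFourierCoeff (fun x => toComplex (f x) - trigInterp u x) k‖ ^ 2 ≤ _
  simp only [hco]
  -- Inside [[N]]^d the error is aliasing plus grid error; outside, the interpolant has no modes and
  -- the tail of f remains.
  rw [← Finset.sum_filter_add_sum_filter_not F (fun k => k ∈ modes d N)]
  refine add_le_add ?_ ?_
  · refine le_trans ?_ (sum_norm_sq_sub_DFT_le hN hs hf hR hfR u)
    calc _ = ∑ k ∈ F with k ∈ modes d N, ‖fourierCoeffVec f k - DFT u k‖ ^ 2 :=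
          Finset.sum_congr rfl fun k hk => by rw [if_pos (Finset.mem_filter.1 hk).2]
      _ ≤ _ := Finset.sum_le_sum_of_subset_of_nonneg (fun k hk => (Finset.mem_filter.1 hk).2)
          fun _ _ _ => by positivity
  · calc _ = ∑ k ∈ F with k ∉ modes d N, ‖fourierCoeffVec f k‖ ^ 2 :=
          Finset.sum_congr rfl fun k hk => by rw [if_neg (Finset.mem_filter.1 hk).2, sub_zero]
      _ ≤ _ := sum_norm_sq_le_of_disjoint_modes hN hfR fun k hk => (Finset.mem_filter.1 hk).2

end Discrete

/-! # Matrices acting on vectors -/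

section Matrices

variable {m n : ℕ}

lemma matVec_sub {𝕜 : Type*} [RCLike 𝕜] (A : Matrix (Fin m) (Fin n) 𝕜)
    (v w : EuclideanSpace 𝕜 (Fin n)) : matVec A (v - w) = matVec A v - matVec A w := by
  ext i; simp [matVec, Matrix.mulVec_sub]

/-- `matVec A` as a continuous linear map. -/
def matVecL {𝕜 : Type*} [RCLike 𝕜] (A : Matrix (Fin m) (Fin n) 𝕜) :
    EuclideanSpace 𝕜 (Fin n) →L[𝕜] EuclideanSpace 𝕜 (Fin m) :=
  LinearMap.toContinuousLinearMap
    { toFun := matVec A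
      map_add' := fun v w => by ext i; simp [matVec, Matrix.mulVec_add]
      map_smul' := fun c v => by ext i; simp [matVec, Matrix.mulVec_smul] }

lemma continuous_matVec {𝕜 : Type*} [RCLike 𝕜] (A : Matrix (Fin m) (Fin n) 𝕜) :
    Continuous (matVec A) := (matVecL A).continuous

lemma norm_matVec_sq_le {𝕜 : Type*} [RCLike 𝕜] (A : Matrix (Fin m) (Fin n) 𝕜)
    (v : EuclideanSpace 𝕜 (Fin n)) : ‖matVec A v‖ ^ 2 ≤ frobSq A * ‖v‖ ^ 2 := by
  simp only [EuclideanSpace.norm_sq_eq, frobSq, Finset.sum_mul]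
  refine Finset.sum_le_sum fun i _ => ?_
  have h1 : ‖(matVec A v) i‖ ≤ ∑ j, ‖A i j‖ * ‖v j‖ := by
    change ‖∑ j, A i j * v j‖ ≤ _
    exact (norm_sum_le _ _).trans_eq (by simp only [norm_mul])
  refine (pow_le_pow_left₀ (norm_nonneg _) h1 2).trans ?_
  rw [← Finset.sum_mul]
  exact Finset.sum_mul_sq_le_sq_mul_sq _ _ _

lemma norm_matVec_le_of_frobSq_le {𝕜 : Type*} [RCLike 𝕜] {A : Matrix (Fin m) (Fin n) 𝕜} {M : ℝ}
    (hM : 0 ≤ M) (hA : frobSq A ≤ M ^ 2) (v : EuclideanSpace 𝕜 (Fin n)) :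
    ‖matVec A v‖ ≤ M * ‖v‖ := by
  refine (pow_le_pow_iff_left₀ (norm_nonneg _) (by positivity) two_ne_zero).1 ?_
  rw [mul_pow]
  exact (norm_matVec_sq_le A v).trans (mul_le_mul_of_nonneg_right hA (by positivity))

lemma norm_matVec_le_induced2Norm (A : Matrix (Fin m) (Fin n) ℝ) (v : RVec n) :
    ‖matVec A v‖ ≤ induced2Norm A * ‖v‖ := Matrix.l2_opNorm_mulVec A v

lemma toComplex_matVec (A : Matrix (Fin m) (Fin n) ℝ) (v : RVec n) :
    toComplex (matVec A v) = matVec (A.map Complex.ofReal) (toComplex v) := by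
  ext i
  simp [toComplex, matVec, Matrix.mulVec, dotProduct]

/-- The second term is the imaginary part. A real matrix acts separately on the two parts, so its
operator bound passes to complex vectors without loss. -/
lemma norm_sq_eq_rePart (z : CVec m) :
    ‖z‖ ^ 2 = ‖rePart z‖ ^ 2 + ‖rePart (-Complex.I • z)‖ ^ 2 := by
  simp only [EuclideanSpace.norm_sq_eq, ← Finset.sum_add_distrib]
  refine Finset.sum_congr rfl fun i _ => ?_
  rw [Complex.sq_norm, Complex.normSq_apply]
  simp [rePart, sq]

lemma rePart_matVec (A : Matrix (Fin m) (Fin n) ℝ) (z : CVec n) :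
    rePart (matVec (A.map Complex.ofReal) z) = matVec A (rePart z) := by
  ext i
  simp [rePart, matVec, Matrix.mulVec, dotProduct]

/-- The complexification of a real matrix has the same operator norm bound. -/
lemma norm_complexify_matVec_le {A : Matrix (Fin m) (Fin n) ℝ} {M : ℝ} (hM : 0 ≤ M)
    (hA : ∀ v, ‖matVec A v‖ ≤ M * ‖v‖) (z : CVec n) :
    ‖matVec (A.map Complex.ofReal) z‖ ≤ M * ‖z‖ := by
  refine (pow_le_pow_iff_left₀ (norm_nonneg _) (by positivity) two_ne_zero).1 ?_
  have h1 : ∀ v, ‖matVec A v‖ ^ 2 ≤ M ^ 2 * ‖v‖ ^ 2 := fun v => by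
    rw [← mul_pow]; exact pow_le_pow_left₀ (norm_nonneg _) (hA v) 2
  rw [norm_sq_eq_rePart, mul_pow, norm_sq_eq_rePart z, mul_add]
  have h2 : -Complex.I • matVec (A.map Complex.ofReal) z
      = matVec (A.map Complex.ofReal) (-Complex.I • z) :=
    ((matVecL (A.map Complex.ofReal)).map_smul (-Complex.I) z).symm
  rw [h2, rePart_matVec, rePart_matVec]
  exact add_le_add (h1 _) (h1 _)

end Matrices

/-! # Sobolev seminorms of preactivations -/

section Preactivation

variable {d m n : ℕ} {s : ℕ}

lemma SeminormLE.mono {f : Torus d → RVec m} {R R' : ℝ} (hR : 0 ≤ R) (h : R ≤ R')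
    (hf : SeminormLE s f R) : SeminormLE s f R' := fun F =>
  (hf F).trans (pow_le_pow_left₀ hR h 2)

lemma SeminormLE.add {f g : Torus d → RVec m} (hfc : Continuous f) (hgc : Continuous g) {R : ℝ}
    (hf : SeminormLE s f R) (hg : SeminormLE s g R) :
    SeminormLE s (fun x => f x + g x) (2 * R) := by
  intro F
  have hco : ∀ k, fourierCoeffVec (fun x => f x + g x) k
      = fourierCoeffVec f k + fourierCoeffVec g k := fourierCoeffVec_add ⟨f, hfc⟩ ⟨g, hgc⟩
  have h1 : ∀ k, ‖fourierCoeffVec f k + fourierCoeffVec g k‖ ^ 2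
      ≤ 2 * ‖fourierCoeffVec f k‖ ^ 2 + 2 * ‖fourierCoeffVec g k‖ ^ 2 := fun k => by
    simpa using norm_sub_sq_le_two_mul (fourierCoeffVec f k) 0 (-fourierCoeffVec g k)
  calc _ ≤ ∑ k ∈ F, (2 * (freqPow s k * ‖fourierCoeffVec f k‖ ^ 2)
          + 2 * (freqPow s k * ‖fourierCoeffVec g k‖ ^ 2)) := by
        refine Finset.sum_le_sum fun k _ => ?_
        rw [hco]
        have := mul_le_mul_of_nonneg_left (h1 k) (freqPow_nonneg s k)
        linarith
    _ ≤ (2 * R) ^ 2 := by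
        rw [Finset.sum_add_distrib, ← Finset.mul_sum, ← Finset.mul_sum]
        have := hf F
        have := hg F
        linarith

/-- A constant lives in the mode 0, whose weight vanishes. -/
lemma SeminormLE.add_const (hs : 1 ≤ s) {f : Torus d → RVec m} (hfc : Continuous f) {R : ℝ}
    (hf : SeminormLE s f R) (b : RVec m) : SeminormLE s (fun x => f x + b) R := by
  intro F
  refine le_trans (Finset.sum_le_sum fun k _ => ?_) (hf F)
  rcases eq_or_ne k 0 with rfl | hk
  · simp [freqPow_zero hs]
  · have hco : fourierCoeffVec (fun x => f x + b) k
        = fourierCoeffVec f k + fourierCoeffVec (fun _ => b) k :=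
      fourierCoeffVec_add ⟨f, hfc⟩ ⟨fun _ => b, continuous_const⟩ k
    have h0 : fourierCoeffVec (fun _ : Torus d => b) k = 0 := by
      have := mFourierCoeff_mFourier_smul (0 : Fin d → ℤ) (toComplex b) k
      rw [if_neg hk.symm] at this
      simp only [mFourier_zero, ContinuousMap.one_apply, one_smul] at this
      exact this
    rw [hco, h0, add_zero]

lemma SeminormLE.matVec {f : Torus d → RVec n} (hfc : Continuous f) {R : ℝ}
    (hf : SeminormLE s f R) {A : Matrix (Fin m) (Fin n) ℝ} {M : ℝ} (hM : 0 ≤ M)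
    (hA : ∀ v, ‖matVec A v‖ ≤ M * ‖v‖) :
    SeminormLE s (fun x => FNO.matVec A (f x)) (M * R) := by
  intro F
  have hco : ∀ k, fourierCoeffVec (fun x => FNO.matVec A (f x)) k
      = FNO.matVec (A.map Complex.ofReal) (fourierCoeffVec f k) := by
    intro k
    have h := (matVecL (A.map Complex.ofReal)).integral_comp_comm
      (integrable_of_continuous (continuous_mFourier_smul (continuous_toComplex.comp hfc) (-k)))
    simp only [map_smul] at h
    refine Eq.trans ?_ h
    simp only [fourierCoeffVec, toComplex_matVec, mFourierCoeff_eq]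
    rfl
  calc _ ≤ ∑ k ∈ F, M ^ 2 * (freqPow s k * ‖fourierCoeffVec f k‖ ^ 2) := by
        refine Finset.sum_le_sum fun k _ => ?_
        rw [hco, mul_left_comm, ← mul_pow]
        exact mul_le_mul_of_nonneg_left (pow_le_pow_left₀ (norm_nonneg _)
          (norm_complexify_matVec_le hM hA _) 2) (freqPow_nonneg s k)
    _ ≤ (M * R) ^ 2 := by
        rw [← Finset.mul_sum, mul_pow]
        exact mul_le_mul_of_nonneg_left (hf F) (by positivity)

open scoped ComplexConjugate in
lemma mFourierCoeff_re {g : Torus d → ℂ} (hg : Continuous g) (k : Fin d → ℤ) :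
    mFourierCoeff (fun x => (((g x).re : ℝ) : ℂ)) k
      = (mFourierCoeff g k + conj (mFourierCoeff g (-k))) / 2 := by
  have h1 : conj (mFourierCoeff g (-k)) = mFourierCoeff (fun x => conj (g x)) k := by
    simp only [mFourierCoeff_eq]
    rw [← integral_conj]
    simp [← mFourier_neg]
  rw [h1, ← mFourierCoeff_add_fun hg (by fun_prop), mFourierCoeff_eq, mFourierCoeff_eq,
    ← integral_div]
  refine integral_congr_ae (Filter.Eventually.of_forall fun x => ?_)
  simp only [Complex.add_conj, smul_eq_mul]
  push_cast
  ring

lemma norm_sq_fourierCoeffVec_rePart_le {p : Torus d → CVec m} (hp : Continuous p)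
    (k : Fin d → ℤ) :
    ‖fourierCoeffVec (fun x => rePart (p x)) k‖ ^ 2
      ≤ (‖mFourierCoeff p k‖ ^ 2 + ‖mFourierCoeff p (-k)‖ ^ 2) / 2 := by
  have hc : ∀ j, Continuous fun x => p x j := fun j => by fun_prop
  have hco : ∀ j, fourierCoeffVec (fun x => rePart (p x)) k j
      = mFourierCoeff (fun x => (((p x j).re : ℝ) : ℂ)) k := fun j =>
    fourierCoeffVec_apply ⟨fun x => rePart (p x), continuous_rePart.comp hp⟩ k j
  simp only [EuclideanSpace.norm_sq_eq, ← Finset.sum_add_distrib, Finset.sum_div]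
  refine Finset.sum_le_sum fun j _ => ?_
  rw [hco, mFourierCoeff_re (hc j), ← mFourierCoeff_apply hp, ← mFourierCoeff_apply hp, norm_div,
    div_pow]
  have h1 := norm_sub_sq_le_two_mul (mFourierCoeff p k j) 0
    (-(starRingEnd ℂ) (mFourierCoeff p (-k) j))
  simp only [sub_neg_eq_add, sub_zero, zero_add, RCLike.norm_conj] at h1
  have h2 : ‖(2 : ℂ)‖ ^ 2 = 4 := by norm_num
  rw [h2]
  linarith

lemma freqPow_neg (k : Fin d → ℤ) : freqPow s (-k) = freqPow s k := by
  simp [freqPow]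

/-- The coefficient of the real part at `k` is the mean of p̂(k) and the conjugate of p̂(-k). As the
weight is even, taking real parts does not increase the bound, even for kernels whose sum is not
real. -/
lemma seminormLE_rePart {p : Torus d → CVec m} (hp : Continuous p) {R : ℝ}
    (h : ∀ F : Finset (Fin d → ℤ), ∑ k ∈ F, freqPow s k * ‖mFourierCoeff p k‖ ^ 2 ≤ R ^ 2) :
    SeminormLE s (fun x => rePart (p x)) R := by
  intro F
  have h1 := h F
  have h2 := h (F.map (Equiv.neg (Fin d → ℤ)).toEmbedding)
  rw [Finset.sum_map] at h2
  simp only [Equiv.coe_toEmbedding, Equiv.neg_apply, freqPow_neg] at h2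
  calc _ ≤ ∑ k ∈ F, (freqPow s k * ‖mFourierCoeff p k‖ ^ 2
          + freqPow s k * ‖mFourierCoeff p (-k)‖ ^ 2) / 2 := by
        refine Finset.sum_le_sum fun k _ => ?_
        have := mul_le_mul_of_nonneg_left (norm_sq_fourierCoeffVec_rePart_le hp k)
          (freqPow_nonneg s k)
        linarith
    _ ≤ R ^ 2 := by
        rw [← Finset.sum_div, Finset.sum_add_distrib]
        linarith

/-- The multiplier acts on each mode separately, so a bound on each single matrix suffices. -/
lemma seminormLE_rePart_multiplier {f : Torus d → RVec n} {R : ℝ} (hf : SeminormLE s f R)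
    (S : Finset (Fin d → ℤ)) {P : (Fin d → ℤ) → Matrix (Fin m) (Fin n) ℂ} {M : ℝ}
    (hP : ∀ k ∈ S, frobSq (P k) ≤ M ^ 2) :
    SeminormLE s (fun x => rePart (∑ k ∈ S, mFourier k x • matVec (P k) (fourierCoeffVec f k)))
      (M * R) := by
  refine seminormLE_rePart (continuous_trigPoly S _) fun F => ?_
  calc _ ≤ ∑ k ∈ F, M ^ 2 * (freqPow s k * ‖fourierCoeffVec f k‖ ^ 2) := by
        refine Finset.sum_le_sum fun k _ => ?_
        rw [mFourierCoeff_trigPoly S fun k => matVec (P k) (fourierCoeffVec f k), mul_left_comm]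
        refine mul_le_mul_of_nonneg_left ?_ (freqPow_nonneg s k)
        split_ifs with hk
        · exact (norm_matVec_sq_le _ _).trans
            (mul_le_mul_of_nonneg_right (hP k hk) (by positivity))
        · rw [norm_zero, zero_pow two_ne_zero]; positivity
    _ ≤ (M * R) ^ 2 := by
        rw [← Finset.mul_sum, mul_pow]
        exact mul_le_mul_of_nonneg_left (hf F) (by positivity)

end Preactivation

/-! # States of a Fourier neural operator -/

section States

variable {d da du T N : ℕ} {Φ : FourierNeuralOperator d da du T} {s : ℕ} {B M : ℝ}

lemma FourierNeuralOperator.Bounded.frobSq_P_le (hΦ : Φ.Bounded s B M) (t : Fin T)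
    {k : Fin d → ℤ} (hk : k ∈ modes d Φ.K) : frobSq (Φ.P t k) ≤ M ^ 2 := by
  have h0 : ∀ k, 0 ≤ frobSq (Φ.P t k) := fun k =>
    by
    unfold frobSq
    exact Finset.sum_nonneg fun _ _ => Finset.sum_nonneg fun _ _ => sq_nonneg _
  refine (Finset.single_le_sum (f := fun k => frobSq (Φ.P t k)) (fun k _ => h0 k) hk).trans ?_
  exact (Real.sqrt_le_iff.1 (hΦ.norm_P t)).2

lemma FourierNeuralOperator.Bounded.norm_matVec_W_le (hΦ : Φ.Bounded s B M) (t : Fin T)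
    (v : RVec (Φ.width t.castSucc)) : ‖matVec (Φ.W t) v‖ ≤ M * ‖v‖ :=
  (norm_matVec_le_induced2Norm _ v).trans
    (mul_le_mul_of_nonneg_right (hΦ.norm_W t) (norm_nonneg _))

lemma FourierNeuralOperator.Bounded.frobSq_lift_le (hΦ : Φ.Bounded s B M) :
    frobSq Φ.lift.A ≤ M ^ 2 := by
  have := (Real.sqrt_le_iff.1 hΦ.norm_lift).2
  nlinarith [sq_nonneg ‖Φ.lift.b‖]

/-- The bound on the Sobolev seminorm of the states of a Fourier neural operator. -/
def stateRadius (d s : ℕ) (B M R : ℝ) : ℕ → ℝ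
  | 0 => compRadius d s B (M * R)
  | t + 1 => compRadius d s B (2 * (M * stateRadius d s B M R t))

lemma stateRadius_nonneg (d s : ℕ) (B M R : ℝ) (t : ℕ) : 0 ≤ stateRadius d s B M R t := by
  cases t <;> exact compRadius_nonneg _ _ _ _

lemma continuous_kernel (Φ : FourierNeuralOperator d da du T) (t : Fin T)
    (v : Torus d → RVec (Φ.width t.castSucc)) : Continuous (Φ.kernel t v) :=
  continuous_rePart.comp (continuous_trigPoly _ _)

lemma continuous_layer (Φ : FourierNeuralOperator d da du T) (t : Fin T)
    {v : Torus d → RVec (Φ.width t.castSucc)} (hv : Continuous v) : Continuous (Φ.layer t v) :=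
  (Φ.σ t).smooth.continuous.comp
    ((((continuous_matVec _).comp hv).add (continuous_kernel Φ t v)).add continuous_const)

lemma seminormLE_layer (hs : (d : ℝ) / 2 < s) (hB : 0 ≤ B) (hM : 0 ≤ M) (hΦ : Φ.Bounded s B M)
    (t : Fin T) {v : Torus d → RVec (Φ.width t.castSucc)} (hv : Continuous v) {R : ℝ}
    (hR : 0 ≤ R) (hvR : SeminormLE s v R) :
    SeminormLE s (Φ.layer t v) (compRadius d s B (2 * (M * R))) := by
  have c1 : Continuous fun x => matVec (Φ.W t) (v x) := (continuous_matVec _).comp hv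
  have c2 := continuous_kernel Φ t v
  have h1 : SeminormLE s (fun x => matVec (Φ.W t) (v x)) (M * R) :=
    hvR.matVec hv hM (hΦ.norm_matVec_W_le t)
  have h2 : SeminormLE s (Φ.kernel t v) (M * R) :=
    seminormLE_rePart_multiplier hvR _ fun k hk => hΦ.frobSq_P_le t hk
  have h3 := (h1.add c1 c2 h2).add_const (one_le_of_half_lt hs) (c1.add c2) (Φ.b t)
  exact h3.comp hs (Φ.σ t).smooth hB (hΦ.deriv_σ t) ((c1.add c2).add continuous_const)
    (by positivity)

lemma continuous_lift (Φ : FourierNeuralOperator d da du T) {a : Torus d → RVec da}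
    (ha : Continuous a) : Continuous fun x => Φ.lift.eval (a x) :=
  Φ.lift.act.smooth.continuous.comp (((continuous_matVec _).comp ha).add continuous_const)

lemma seminormLE_lift (hs : (d : ℝ) / 2 < s) (hB : 0 ≤ B) (hM : 0 ≤ M) (hΦ : Φ.Bounded s B M)
    {a : Torus d → RVec da} (ha : Continuous a) {R : ℝ} (hR : 0 ≤ R) (haR : SeminormLE s a R) :
    SeminormLE s (fun x => Φ.lift.eval (a x)) (compRadius d s B (M * R)) := by
  have c1 : Continuous fun x => matVec Φ.lift.A (a x) := (continuous_matVec _).comp ha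
  have h1 : SeminormLE s (fun x => matVec Φ.lift.A (a x)) (M * R) :=
    haR.matVec ha hM (norm_matVec_le_of_frobSq_le hM hΦ.frobSq_lift_le)
  exact (h1.add_const (one_le_of_half_lt hs) c1 Φ.lift.b).comp hs Φ.lift.act.smooth hB
    hΦ.deriv_lift (c1.add continuous_const) (by positivity)

lemma modeSum_sub (Φ : FourierNeuralOperator d da du T) (t : Fin T)
    (c c' : (Fin d → ℤ) → CVec (Φ.width t.castSucc)) (x : Torus d) :
    Φ.modeSum t c x - Φ.modeSum t c' x
      = rePart (∑ k ∈ modes d Φ.K, mFourier k x • matVec (Φ.P t k) (c k - c' k)) := by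
  simp only [FourierNeuralOperator.modeSum, matVec_sub, smul_sub, Finset.sum_sub_distrib,
    ← rePartL_apply, map_sub]

/-- The propagation of the discretization error through a layer. -/
lemma gridSq_layer_sub_le (hs : (d : ℝ) / 2 < s)
    (hΦ : Φ.Bounded s B M) (hN : 0 < N) (hK : Φ.K ≤ N) (t : Fin T)
    {v : Torus d → RVec (Φ.width t.castSucc)} (hv : Continuous v) {R : ℝ} (hR : 0 ≤ R)
    (hvR : SeminormLE s v R) (u : (Fin d → Fin N) → RVec (Φ.width t.castSucc)) :
    gridSq (fun n => Φ.layer t v (gridPoint n) - Φ.layerN t u n)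
      ≤ B ^ 2 * M ^ 2 * (6 * gridSq (fun n => v (gridPoint n) - u n)
        + 4 * ((2 / N) ^ (2 * s) * latticeSum d s * R ^ 2)) := by
  set e := gridSq (fun n => v (gridPoint n) - u n) with he
  let c : (Fin d → ℤ) → CVec (Φ.width t.succ) := fun k =>
    matVec (Φ.P t k) (fourierCoeffVec v k - DFT u k)
  let q : (Fin d → Fin N) → CVec (Φ.width t.succ) := fun n =>
    ∑ k ∈ modes d Φ.K, mFourier k (gridPoint n) • c k
  -- Since K ≤ N, grid Parseval turns the kernel error into a sum over modes, bounded by the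
  -- aliasing and grid errors of v.
  have hq : gridSq q ≤ M ^ 2 * (2 * ((2 / N) ^ (2 * s) * latticeSum d s * R ^ 2) + 2 * e) := by
    calc gridSq q = ∑ k ∈ modes d Φ.K, ‖c k‖ ^ 2 := gridSq_trigPoly hN (modes_subset hK) c
      _ ≤ ∑ k ∈ modes d Φ.K, M ^ 2 * ‖fourierCoeffVec v k - DFT u k‖ ^ 2 :=
          Finset.sum_le_sum fun k hk => (norm_matVec_sq_le _ _).trans
            (mul_le_mul_of_nonneg_right (hΦ.frobSq_P_le t hk) (by positivity))
      _ ≤ M ^ 2 * ∑ k ∈ modes d N, ‖fourierCoeffVec v k - DFT u k‖ ^ 2 := by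
          rw [← Finset.mul_sum]
          exact mul_le_mul_of_nonneg_left (Finset.sum_le_sum_of_subset_of_nonneg
            (modes_subset hK) fun _ _ _ => by positivity) (by positivity)
      _ ≤ _ := mul_le_mul_of_nonneg_left (sum_norm_sq_sub_DFT_le hN hs hv hR hvR u)
          (by positivity)
  have hpt : ∀ n, ‖Φ.layer t v (gridPoint n) - Φ.layerN t u n‖ ^ 2
      ≤ B ^ 2 * (2 * (M ^ 2 * ‖v (gridPoint n) - u n‖ ^ 2) + 2 * ‖q n‖ ^ 2) := by
    intro n
    have h1 := norm_sub_le_of_derivBounded (one_le_of_half_lt hs) (Φ.σ t).smooth (hΦ.deriv_σ t)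
      (matVec (Φ.W t) (v (gridPoint n)) + Φ.kernel t v (gridPoint n) + Φ.b t)
      (matVec (Φ.W t) (u n) + Φ.kernelN t u n + Φ.b t)
    -- The double negation presents the sum as x - z, to be split by `norm_sub_sq_le_two_mul` with y
    -- = 0.
    have h2 : matVec (Φ.W t) (v (gridPoint n)) + Φ.kernel t v (gridPoint n) + Φ.b t
        - (matVec (Φ.W t) (u n) + Φ.kernelN t u n + Φ.b t)
        = matVec (Φ.W t) (v (gridPoint n) - u n) - -rePart (q n) := by
      have := modeSum_sub Φ t (fourierCoeffVec v) (DFT u) (gridPoint n)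
      simp only [q, c]
      rw [← this, matVec_sub, FourierNeuralOperator.kernel, FourierNeuralOperator.kernelN]
      abel
    rw [h2] at h1
    have h3 := norm_sub_sq_le_two_mul (matVec (Φ.W t) (v (gridPoint n) - u n)) 0
      (-rePart (q n))
    rw [sub_zero, zero_sub, neg_neg] at h3
    calc _ ≤ (B * ‖matVec (Φ.W t) (v (gridPoint n) - u n) - -rePart (q n)‖) ^ 2 :=
          pow_le_pow_left₀ (norm_nonneg _) h1 2
      _ = B ^ 2 * ‖matVec (Φ.W t) (v (gridPoint n) - u n) - -rePart (q n)‖ ^ 2 := mul_pow _ _ _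
      _ ≤ _ := by
          refine mul_le_mul_of_nonneg_left (h3.trans ?_) (by positivity)
          have h4 := pow_le_pow_left₀ (norm_nonneg _)
            (hΦ.norm_matVec_W_le t (v (gridPoint n) - u n)) 2
          have h5 := pow_le_pow_left₀ (norm_nonneg _) (norm_rePart_le (q n)) 2
          rw [mul_pow] at h4
          linarith
  calc gridSq (fun n => Φ.layer t v (gridPoint n) - Φ.layerN t u n)
      ≤ ((N : ℝ) ^ d)⁻¹ * ∑ n, B ^ 2 * (2 * (M ^ 2 * ‖v (gridPoint n) - u n‖ ^ 2)
          + 2 * ‖q n‖ ^ 2) :=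
        mul_le_mul_of_nonneg_left (Finset.sum_le_sum fun n _ => hpt n) (by positivity)
    -- In the final constants, 6 = 2 + 2·2 collects the local and kernel parts of the grid error,
    -- and 4 = 2·2 multiplies the aliasing term.
    _ = B ^ 2 * (2 * (M ^ 2 * e) + 2 * gridSq q) := by
        simp only [← Finset.mul_sum, Finset.sum_add_distrib, he, gridSq]
        ring
    _ ≤ B ^ 2 * (2 * (M ^ 2 * e) + 2 * (M ^ 2 *
          (2 * ((2 / N) ^ (2 * s) * latticeSum d s * R ^ 2) + 2 * e))) := by gcongr
    _ = _ := by ring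

/-- The constants in the bound on the discretization error of the states. -/
def stateError (d s : ℕ) (B M R : ℝ) : ℕ → ℝ
  | 0 => 0
  | t + 1 => B ^ 2 * M ^ 2 * (6 * stateError d s B M R t
      + 4 * (latticeSum d s * stateRadius d s B M R t ^ 2))

/-- Regularity of the continuum states, and the discretization error on the grid. -/
lemma state_bounds (hs : (d : ℝ) / 2 < s) (hB : 0 ≤ B) (hM : 0 ≤ M) (hΦ : Φ.Bounded s B M)
    (hN : 0 < N) (hK : Φ.K ≤ N) {a : Torus d → RVec da} (ha : Continuous a) {R : ℝ}
    (hR : 0 ≤ R) (haR : SeminormLE s a R) (t : Fin (T + 1)) :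
    Continuous (Φ.state a t) ∧ SeminormLE s (Φ.state a t) (stateRadius d s B M R t) ∧
      gridSq (fun n : Fin d → Fin N => Φ.state a t (gridPoint n) - Φ.stateN N a t n)
        ≤ (2 / N) ^ (2 * s) * stateError d s B M R t := by
  induction t using Fin.induction with
  | zero =>
    refine ⟨continuous_lift Φ ha, seminormLE_lift hs hB hM hΦ ha hR haR, ?_⟩
    have : ∀ n : Fin d → Fin N, Φ.state a 0 (gridPoint n) - Φ.stateN N a 0 n = 0 :=
      fun n => sub_self _
    simp [this, gridSq, stateError]
  | succ t ih =>
    obtain ⟨hc, hr, he⟩ := ih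
    have hr0 := stateRadius_nonneg d s B M R t
    refine ⟨continuous_layer Φ t hc, seminormLE_layer hs hB hM hΦ t hc hr0 hr, ?_⟩
    refine (gridSq_layer_sub_le hs hΦ hN hK t hc hr0 hr (Φ.stateN N a t.castSucc)).trans ?_
    rw [Fin.val_castSucc] at he
    rw [Fin.val_succ, stateError]
    calc _ ≤ B ^ 2 * M ^ 2 * (6 * ((2 / N) ^ (2 * s) * stateError d s B M R t)
          + 4 * ((2 / N) ^ (2 * s) * latticeSum d s * stateRadius d s B M R t ^ 2)) := by
          gcongr
      _ = _ := by ring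

lemma seminormLE_sobolevSpace (f : SobolevSpace d da s) : SeminormLE s f.toFun ‖f‖ := by
  intro F
  rw [SobolevSpace.norm_sq_eq]
  refine le_trans (Finset.sum_le_sum fun k _ => ?_)
    (Summable.sum_le_tsum (f := fun k => sobolevWeight s k * ‖fourierCoeffVec f.toFun k‖ ^ 2) F
      (fun k _ => mul_nonneg (sobolevWeight_pos s k).le (by positivity)) f.2)
  refine mul_le_mul_of_nonneg_right ?_ (by positivity)
  simp [freqPow, sobolevWeight]

end States

end

end FNO

/-! ### The convergence rate -/

theorem theorem2 (d da s : ℕ) (hs : (d : ℝ) / 2 < s) (B M : ℝ) (hB : 1 ≤ B) (hM : 1 ≤ M)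
    (Ac : Set (FNO.SobolevSpace d da s)) (hAc : IsCompact Ac) :
    ∃ C' : ℕ → ℝ, ∀ (du T : ℕ) (Φ : FNO.FourierNeuralOperator d da du T), Φ.Bounded s B M →
      ∀ N : ℕ, 1 ≤ Φ.K → (Φ.K : ℝ) < (N : ℝ) / 2 → ∀ t : Fin (T + 1),
        ⨆ a ∈ Ac, eLpNorm
            (fun x => FNO.toComplex (Φ.state a.toFun t x)
              - FNO.trigInterp (Φ.stateN N a.toFun t) x)
            2 (FNO.torusMeasure d)
          ≤ ENNReal.ofReal (C' t * (N : ℝ) ^ (-(s : ℤ))) := by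
  obtain ⟨R, hR0, hR⟩ : ∃ R : ℝ, 0 ≤ R ∧ ∀ a ∈ Ac, ‖a‖ ≤ R := by
    obtain ⟨R, hR⟩ := hAc.isBounded.exists_norm_le
    -- For empty `Ac` the bound obtained could be negative.
    exact ⟨max R 0, le_max_right _ _, fun a ha => (hR a ha).trans (le_max_left _ _)⟩
  -- The three terms are the aliasing, grid and truncation errors; 2^s is what remains of (2/N)^{2s}
  -- under the root once N^{-s} is taken out. The constants are fixed before `T`, `Φ` and `N`.
  refine ⟨fun t => 2 ^ s * Real.sqrt (2 * (FNO.latticeSum d s * FNO.stateRadius d s B M R t ^ 2)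
    + 2 * FNO.stateError d s B M R t + FNO.stateRadius d s B M R t ^ 2), ?_⟩
  intro du T Φ hΦ N hK1 hKN t
  have hK : Φ.K ≤ N := by
    have : (Φ.K : ℝ) ≤ N := by
      have : (0 : ℝ) ≤ Φ.K := by positivity
      linarith
    exact_mod_cast this
  have hN : 0 < N := by omega
  refine iSup₂_le fun a ha => ?_
  have hac : Continuous a.toFun := a.1.continuous
  have haR : FNO.SeminormLE s a.toFun R := (FNO.seminormLE_sobolevSpace a).mono (norm_nonneg a)
    (hR a ha)
  obtain ⟨hc, hr, he⟩ := FNO.state_bounds hs (by linarith) (by linarith) hΦ hN hK hac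
    hR0 haR t
  rw [FNO.eLpNorm_two_eq
    (g := fun x => FNO.toComplex (Φ.state a.toFun t x) - FNO.trigInterp (Φ.stateN N a.toFun t) x)
    ((FNO.continuous_toComplex.comp hc).sub (FNO.continuous_trigInterp _))]
  refine ENNReal.ofReal_le_ofReal ?_
  have h1 := FNO.integral_norm_sq_sub_trigInterp_le hN hs hc
    (FNO.stateRadius_nonneg d s B M R t) hr (Φ.stateN N a.toFun t)
  have e1 : (2 : ℝ) ^ s * (N : ℝ) ^ (-(s : ℤ)) = (2 / N) ^ s := by
    rw [zpow_neg, zpow_natCast, div_pow, div_eq_mul_inv]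
  rw [mul_right_comm, e1]
  have h2 : (0 : ℝ) ≤ (2 / N) ^ s := by positivity
  rw [← Real.sqrt_sq h2, ← Real.sqrt_mul (sq_nonneg _)]
  refine Real.sqrt_le_sqrt (h1.trans ?_)
  rw [← pow_mul, mul_comm s 2]
  linarith
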